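/- **Theorem 1.8.** Let $d\in\mathbb N$ and let $\mathbb B^d=\{x\in\mathbb R^d: |x|\le 1\}$, where $\mathbb R^d$ is identified with the interior of $\mathbb B^d$ via $x\mapsto x/\langle x\rangle$, $\langle x\rangle=\sqrt{1+|x|^2}$, and $\mathbb S^{d-1}=\partial\mathbb B^d$ is the set of directions at infinity. For every closed set $\Gamma\subset\partial(\mathbb B^d\times\mathbb B^d)=(\mathbb R^d\times\mathbb S^{d-1})\cup(\mathbb S^{d-1}\times\mathbb R^d)\cup(\mathbb S^{d-1}\times\mathbb S^{d-1})$ there exists a tempered distribution $T\in\mathcal S'(\mathbb R^d)$ whose global wave front set satisfies $\mathrm{WF}(T)=\Gamma$. Here $\widehat u$ denotes the Fourier transform with kernel $e^{-i\langle x,\xi\rangle}$. Given a cut-off $\phi\in C_c^\infty(\mathbb R^d)$ with $\phi\equiv1$ near $0$, put $\psi_R(x)=(1-\phi(x/R))\,\psi(x/|x|)$ for $\psi\in C^\infty(\mathbb S^{d-1})$ and $R>0$. The cone singular support of $u\in\mathcal S'(\mathbb R^d)$ is the subset of $\mathbb B^d$ $$\mathrm{Css}(u)=\mathrm{singsupp}(u)\cup\{\omega\in\mathbb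 S^{d-1}:\ \text{there are no } R>0,\ \psi\in C^\infty(\mathbb S^{d-1}) \text{ with } \psi(\omega)\ne0 \text{ and } \psi_R u\in\mathcal S(\mathbb R^d)\},$$ and the global wave front set of $u$ is the subset of $\mathbb B^d\times\mathbb B^d$ $$\mathrm{WF}(u)=\mathrm{WF}_{cl}(u)\cup\{(\omega,\xi)\in\mathbb S^{d-1}\times\mathbb B^d:\ \text{there are no } R>0,\ \psi\in C^\infty(\mathbb S^{d-1}) \text{ with } \psi(\omega)\neq0 \text{ and } \xi\notin\mathrm{Css}(\widehat{\psi_R u})\},$$ where $\mathrm{WF}_{cl}(u)\subset\mathbb R^d\times\mathbb S^{d-1}$ is Hörmander's classical wave front set. The same $T$ satisfies $\mathrm{WF}(T)=\Gamma$ for every choice of the cut-off $\phi$. -/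

import Mathlib

open MeasureTheory Metric Set Topology
open scoped SchwartzMap ContDiff

/-! # Global wave front sets of tempered distributions

Throughout, `EuclideanSpace ℝ (Fin d)` is `ℝ^d`, and `𝓢'(EuclideanSpace ℝ (Fin d), ℂ)` is the space
of (complex valued) tempered distributions on it. The ball `𝔹^d` is the closed unit ball; it is the
union of the image of `ℝ^d` under `x ↦ x / ⟨x⟩` and of the sphere of directions at infinity. -/

namespace GlobalWF

/-- The embedding `x ↦ x / ⟨x⟩`, `⟨x⟩ = (1 + |x|²)^(1/2)`, of `ℝ^d` onto the interior of `𝔹^d`. -/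
noncomputable def toBall {d : ℕ} (x : EuclideanSpace ℝ (Fin d)) : EuclideanSpace ℝ (Fin d) :=
  (Real.sqrt (1 + ‖x‖ ^ 2))⁻¹ • x

/-- A cut-off function: smooth, compactly supported, identically `1` in a neighbourhood of `0`. -/
structure IsCutoff {d : ℕ} (φ : EuclideanSpace ℝ (Fin d) → ℂ) : Prop where
  contDiff : ContDiff ℝ ∞ φ
  hasCompactSupport : HasCompactSupport φ
  eventually_eq_one : ∀ᶠ x in 𝓝 0, φ x = 1

/-- Smooth functions on the sphere `𝕊^(d-1)`, identified with the functions which are smooth and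
positively homogeneous of degree `0` on `ℝ^d ∖ {0}` (the value at `0` plays no role). -/
structure IsAngular {d : ℕ} (ψ : EuclideanSpace ℝ (Fin d) → ℂ) : Prop where
  contDiffOn : ContDiffOn ℝ ∞ ψ {0}ᶜ
  homogeneous : ∀ t : ℝ, 0 < t → ∀ x, x ≠ 0 → ψ (t • x) = ψ x

/-- The asymptotic cut-off `ψ_R(x) = (1 - φ(x / R)) ψ(x / |x|)`, where `ψ(x / |x|) = ψ(x)` by
homogeneity. -/
noncomputable def asympCutoff {d : ℕ} (φ ψ : EuclideanSpace ℝ (Fin d) → ℂ) (R : ℝ) :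
    EuclideanSpace ℝ (Fin d) → ℂ :=
  fun x => (1 - φ (R⁻¹ • x)) * ψ x

/-- Asymptotic cut-offs have temperate growth, so that multiplication by them is the genuine
operation on tempered distributions. -/
theorem asympCutoff_hasTemperateGrowth {d : ℕ} {φ ψ : EuclideanSpace ℝ (Fin d) → ℂ}
    (hφ : IsCutoff φ) (hψ : IsAngular ψ) {R : ℝ} (hR : 0 < R) :
    (asympCutoff φ ψ R).HasTemperateGrowth := by
  have hsm : ContDiff ℝ ∞ (asympCutoff φ ψ R) := by
    rw [contDiff_iff_contDiffAt]
    intro x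
    by_cases hx : x = 0
    · subst hx
      have h0 : asympCutoff φ ψ R =ᶠ[𝓝 0] fun _ => 0 := by
        have hc : Filter.Tendsto (fun x : EuclideanSpace ℝ (Fin d) => R⁻¹ • x) (𝓝 0) (𝓝 0) := by
          have : Continuous (fun x : EuclideanSpace ℝ (Fin d) => R⁻¹ • x) := by fun_prop
          simpa using this.tendsto 0
        filter_upwards [hc.eventually hφ.eventually_eq_one] with x hx
        simp [asympCutoff, hx]
      exact contDiffAt_const.congr_of_eventuallyEq h0
    · have h1 : ContDiffAt ℝ ∞ ψ x :=
        (hψ.contDiffOn x hx).contDiffAt (isOpen_compl_singleton.mem_nhds hx)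
      have h2 : ContDiff ℝ ∞ (fun x : EuclideanSpace ℝ (Fin d) => 1 - φ (R⁻¹ • x)) :=
        contDiff_const.sub (hφ.contDiff.comp (contDiff_const_smul _))
      exact h2.contDiffAt.mul h1
  refine ⟨hsm, fun n => ?_⟩
  have hn : ((n : ℕ∞) : WithTop ℕ∞) ≤ ∞ := mod_cast le_top
  obtain ⟨r, hr⟩ := hφ.hasCompactSupport.isCompact.isBounded.subset_closedBall 0
  set ρ : ℝ := max 1 (R * r) with hρ
  obtain ⟨M, hM⟩ := (isCompact_sphere (0 : EuclideanSpace ℝ (Fin d)) (1 : ℝ)).exists_bound_of_continuousOn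
    (f := iteratedFDeriv ℝ n ψ) (by
      have := hψ.contDiffOn.continuousOn_iteratedFDerivWithin hn isOpen_compl_singleton.uniqueDiffOn
      have h' : ContinuousOn (iteratedFDeriv ℝ n ψ) {0}ᶜ :=
        this.congr fun x hx => (iteratedFDerivWithin_of_isOpen n isOpen_compl_singleton hx).symm
      refine h'.mono fun x hx => ?_
      rintro rfl
      simp at hx)
  obtain ⟨M', hM'⟩ := (isCompact_closedBall (0 : EuclideanSpace ℝ (Fin d)) ρ).exists_bound_of_continuousOn
    (hsm.continuous_iteratedFDeriv hn).continuousOn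
  refine ⟨0, max M M', fun x => ?_⟩
  simp only [pow_zero, mul_one]
  by_cases hx : ‖x‖ ≤ ρ
  · exact (hM' x (by simpa using hx)).trans (le_max_right _ _)
  · push Not at hx
    have hx1 : 1 < ‖x‖ := (le_max_left _ _).trans_lt hx
    have hx0 : x ≠ 0 := by
      rintro rfl
      simp at hx1
      linarith
    have e1 : asympCutoff φ ψ R =ᶠ[𝓝 x] ψ := by
      filter_upwards [(isOpen_lt continuous_const continuous_norm).mem_nhds hx] with y hy
      have hy' : ρ < ‖y‖ := hy
      have hz : φ (R⁻¹ • y) = 0 := by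
        by_contra hne
        have := hr (subset_tsupport _ (Function.mem_support.2 hne))
        rw [mem_closedBall_zero_iff, norm_smul, norm_inv, Real.norm_of_nonneg hR.le,
          inv_mul_le_iff₀ hR] at this
        have := (le_max_right 1 (R * r)).trans_lt hy'
        linarith
      simp [asympCutoff, hz]
    rw [(Filter.EventuallyEq.iteratedFDeriv ℝ e1 n).eq_of_nhds]
    have ht : (‖x‖⁻¹ : ℝ) ≠ 0 := by positivity
    let g : EuclideanSpace ℝ (Fin d) ≃L[ℝ] EuclideanSpace ℝ (Fin d) :=
      ContinuousLinearEquiv.smulLeft (Units.mk0 (‖x‖⁻¹ : ℝ) ht)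
    have hg : ∀ y, g y = ‖x‖⁻¹ • y := fun y => rfl
    have e2 : ψ =ᶠ[𝓝 x] ψ ∘ g := by
      filter_upwards [isOpen_compl_singleton.mem_nhds hx0] with y hy
      simp only [Function.comp, hg]
      exact (hψ.homogeneous _ (by positivity) y hy).symm
    have e3 : iteratedFDeriv ℝ n (ψ ∘ g) x =
        (iteratedFDeriv ℝ n ψ (g x)).compContinuousLinearMap (fun _ => (g : _ →L[ℝ] _)) := by
      have := g.iteratedFDerivWithin_comp_right ψ uniqueDiffOn_univ (x := x) (mem_univ _) n
      simpa [iteratedFDerivWithin_univ] using this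
    rw [(Filter.EventuallyEq.iteratedFDeriv ℝ e2 n).eq_of_nhds, e3]
    refine (ContinuousMultilinearMap.norm_compContinuousLinearMap_le _ _).trans ?_
    have hgn : ‖(g : EuclideanSpace ℝ (Fin d) →L[ℝ] EuclideanSpace ℝ (Fin d))‖ ≤ 1 := by
      refine ContinuousLinearMap.opNorm_le_bound _ zero_le_one fun y => ?_
      rw [ContinuousLinearEquiv.coe_coe, hg, norm_smul, norm_inv, norm_norm]
      gcongr
      exact inv_le_one_of_one_le₀ hx1.le
    have hgx : ‖iteratedFDeriv ℝ n ψ (g x)‖ ≤ M := by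
      apply hM
      rw [mem_sphere_zero_iff_norm, hg, norm_smul, norm_inv, norm_norm]
      exact inv_mul_cancel₀ (by positivity)
    calc _ ≤ ‖iteratedFDeriv ℝ n ψ (g x)‖ * 1 := by
          gcongr
          exact Finset.prod_le_one (fun _ _ => norm_nonneg _) (fun _ _ => hgn)
      _ ≤ M := by simpa using hgx
      _ ≤ _ := le_max_left _ _

/-- The plane wave `x ↦ exp(-i ⟨x, ξ⟩)`. -/
noncomputable def planeWave {d : ℕ} (ξ : EuclideanSpace ℝ (Fin d)) :
    EuclideanSpace ℝ (Fin d) → ℂ :=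
  fun x => Complex.exp (-Complex.I * (inner ℝ x ξ : ℝ))

/-- Plane waves have temperate growth, so that multiplication by them is the genuine operation. -/
theorem planeWave_hasTemperateGrowth {d : ℕ} (ξ : EuclideanSpace ℝ (Fin d)) :
    (planeWave ξ).HasTemperateGrowth := by
  have key : Function.HasTemperateGrowth (fun t : ℝ => Complex.exp (-Complex.I * (t : ℂ))) := by
    have hd : ∀ n : ℕ, iteratedDeriv n (fun t : ℝ => Complex.exp (-Complex.I * (t : ℂ))) =
        fun t : ℝ => (-Complex.I) ^ n * Complex.exp (-Complex.I * (t : ℂ)) := by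
      intro n
      induction n with
      | zero => simp
      | succ n ih =>
        rw [iteratedDeriv_succ, ih]
        funext t
        have h1 : HasDerivAt (fun t : ℝ => -Complex.I * (t : ℂ)) (-Complex.I) t := by
          simpa using (Complex.ofRealCLM.hasDerivAt (x := t)).const_mul (-Complex.I)
        rw [(h1.cexp.const_mul ((-Complex.I) ^ n)).deriv]
        ring
    refine ⟨(contDiff_const.mul Complex.ofRealCLM.contDiff).cexp, fun n => ⟨0, 1, fun t => ?_⟩⟩
    rw [norm_iteratedFDeriv_eq_norm_iteratedDeriv, hd, norm_mul, norm_pow, norm_neg,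
      Complex.norm_I, one_pow, one_mul, Complex.norm_exp]
    simp
  exact key.comp (Function.hasTemperateGrowth_inner_left ξ)

/-- The Fourier transform `f̂(ξ) = ∫ exp(-i ⟨x, ξ⟩) f(x) dx` on Schwartz functions. Mathlib's `𝓕` has
the kernel `exp(-2πi ⟨x, ξ⟩)`, hence the rescaling `f̂(ξ) = 𝓕 f (ξ / (2π))`. -/
noncomputable def fourierSchwartz (d : ℕ) :
    𝓢(EuclideanSpace ℝ (Fin d), ℂ) →L[ℂ] 𝓢(EuclideanSpace ℝ (Fin d), ℂ) :=
  SchwartzMap.compCLMOfContinuousLinearEquiv ℂ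
      (ContinuousLinearEquiv.smulLeft (Units.mk0 ((2 * Real.pi)⁻¹ : ℝ) (by positivity))) ∘L
    FourierTransform.fourierCLM ℂ 𝓢(EuclideanSpace ℝ (Fin d), ℂ)

theorem fourierSchwartz_apply {d : ℕ} (f : 𝓢(EuclideanSpace ℝ (Fin d), ℂ))
    (ξ : EuclideanSpace ℝ (Fin d)) :
    fourierSchwartz d f ξ = ∫ x, planeWave ξ x * f x := by
  change FourierTransform.fourier f ((2 * Real.pi)⁻¹ • ξ) = _
  rw [SchwartzMap.fourier_coe, Real.fourier_eq']
  refine integral_congr_ae (.of_forall fun x => ?_)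
  simp only [planeWave, smul_eq_mul, inner_smul_right]
  congr 2
  have : (Real.pi : ℂ) ≠ 0 := by exact_mod_cast Real.pi_ne_zero
  push_cast
  field_simp

/-- The Fourier transform of tempered distributions, `⟨û, f⟩ = ⟨u, f̂⟩`. -/
noncomputable def fourierDistr {d : ℕ} (u : 𝓢'(EuclideanSpace ℝ (Fin d), ℂ)) :
    𝓢'(EuclideanSpace ℝ (Fin d), ℂ) :=
  PointwiseConvergenceCLM.precomp ℂ (fourierSchwartz d) u

/-- The tempered distribution `u` belongs to `𝓢`. -/
def IsSchwartz {d : ℕ} (u : 𝓢'(EuclideanSpace ℝ (Fin d), ℂ)) : Prop :=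
  ∃ s : 𝓢(EuclideanSpace ℝ (Fin d), ℂ), ∀ f : 𝓢(EuclideanSpace ℝ (Fin d), ℂ),
    u f = ∫ x, s x * f x

/-- The singular support: the complement of the set of the points which have an open neighbourhood
on which `u` is a smooth function. -/
def singSupp {d : ℕ} (u : 𝓢'(EuclideanSpace ℝ (Fin d), ℂ)) : Set (EuclideanSpace ℝ (Fin d)) :=
  {x | ∃ U : Set (EuclideanSpace ℝ (Fin d)), IsOpen U ∧ x ∈ U ∧
    ∃ h : EuclideanSpace ℝ (Fin d) → ℂ, ContDiffOn ℝ ∞ h U ∧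
      ∀ f : 𝓢(EuclideanSpace ℝ (Fin d), ℂ), HasCompactSupport f → tsupport f ⊆ U →
        u f = ∫ y, h y * f y}ᶜ

/-- The cone singular support, a subset of `𝔹^d`: the (embedded) singular support, together with the
directions `θ` at infinity for which no asymptotic cut-off `ψ_R` with `ψ(θ) ≠ 0` satisfies
`ψ_R u ∈ 𝓢`. -/
noncomputable def coneSingSupp {d : ℕ} (φ : EuclideanSpace ℝ (Fin d) → ℂ)
    (u : 𝓢'(EuclideanSpace ℝ (Fin d), ℂ)) : Set (EuclideanSpace ℝ (Fin d)) :=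
  toBall '' singSupp u ∪
    {θ | θ ∈ sphere (0 : EuclideanSpace ℝ (Fin d)) 1 ∧
      ¬ ∃ R : ℝ, 0 < R ∧ ∃ ψ : EuclideanSpace ℝ (Fin d) → ℂ, IsAngular ψ ∧ ψ θ ≠ 0 ∧
        IsSchwartz (TemperedDistribution.smulLeftCLM ℂ (asympCutoff φ ψ R) u)}

/-- The Fourier transform `ξ ↦ ⟨u, χ exp(-i ⟨·, ξ⟩)⟩` of the compactly supported distribution `χ u`,
for `χ` smooth with compact support; it is a function. -/
noncomputable def localFourier {d : ℕ} (u : 𝓢'(EuclideanSpace ℝ (Fin d), ℂ))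
    (χ : 𝓢(EuclideanSpace ℝ (Fin d), ℂ)) (ξ : EuclideanSpace ℝ (Fin d)) : ℂ :=
  u (SchwartzMap.smulLeftCLM ℂ (planeWave ξ) χ)

/-- Hörmander's wave front set, as a subset of `ℝ^d × 𝕊^(d-1)`: the pair `(x, η)` does not belong to
it if and only if there are a test function `χ` with `χ(x) ≠ 0` and an open cone `V` around `η` in
which the Fourier transform of `χ u` is rapidly decreasing. -/
def classicalWF {d : ℕ} (u : 𝓢'(EuclideanSpace ℝ (Fin d), ℂ)) :
    Set (EuclideanSpace ℝ (Fin d) × EuclideanSpace ℝ (Fin d)) :=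
  {p | p.2 ∈ sphere (0 : EuclideanSpace ℝ (Fin d)) 1 ∧
    ¬ ∃ χ : 𝓢(EuclideanSpace ℝ (Fin d), ℂ), HasCompactSupport χ ∧ χ p.1 ≠ 0 ∧
      ∃ V : Set (EuclideanSpace ℝ (Fin d)), IsOpen V ∧ (∀ t : ℝ, 0 < t → ∀ ξ ∈ V, t • ξ ∈ V) ∧
        p.2 ∈ V ∧ ∀ N : ℕ, ∃ C : ℝ, ∀ ξ ∈ V, (1 + ‖ξ‖) ^ N * ‖localFourier u χ ξ‖ ≤ C}

/-- The global wave front set, a subset of `𝔹^d × 𝔹^d`: the (embedded) classical wave front set,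
together with the pairs `(θ, ζ) ∈ 𝕊^(d-1) × 𝔹^d` for which no asymptotic cut-off `ψ_R` with
`ψ(θ) ≠ 0` satisfies `ζ ∉ Css((ψ_R u)^)`. The cut-off `φ` is the one which enters `ψ_R`. -/
noncomputable def globalWF {d : ℕ} (φ : EuclideanSpace ℝ (Fin d) → ℂ)
    (u : 𝓢'(EuclideanSpace ℝ (Fin d), ℂ)) :
    Set (EuclideanSpace ℝ (Fin d) × EuclideanSpace ℝ (Fin d)) :=
  (fun p => (toBall p.1, p.2)) '' classicalWF u ∪
    {p | p.1 ∈ sphere (0 : EuclideanSpace ℝ (Fin d)) 1 ∧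
      p.2 ∈ closedBall (0 : EuclideanSpace ℝ (Fin d)) 1 ∧
      ¬ ∃ ψ : EuclideanSpace ℝ (Fin d) → ℂ, IsAngular ψ ∧ ψ p.1 ≠ 0 ∧ ∃ R : ℝ, 0 < R ∧
        p.2 ∉ coneSingSupp φ
          (fourierDistr (TemperedDistribution.smulLeftCLM ℂ (asympCutoff φ ψ R) u))}

end GlobalWF

/-! # Distributions with prescribed global wave front set

The distribution is a lacunary sum of multiples of wave packets `exp(i ⟨x, ξ_k⟩) ρ((x - x_k) /
w_k)`, whose centers `(x_k, ξ_k)` follow, in the compactified phase space `𝔹^d × 𝔹^d`, a sequence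
which runs infinitely often through a countable dense subset of `Γ`. As `Γ` lies in the boundary,
either the frequency `ξ_k` or the position `x_k` can be placed exactly at distance `s_k²` from the
origin, where `s_k → ∞` rapidly; in the first case the packet has width `w_k = 1 / s_k`, and in the
second case `w_k = s_k`. (In the first case, it is the Fourier transform of the packet which has the
compactly supported profile `ρ`.) With this choice, both the packet and its Fourier transform are
concentrated at a scale which is negligible, in the compactified phase space, compared with the
distance to any fixed point different from the limit points of the centers. The packets which are
far out in position have disjoint supports, and so have the Fourier transforms of those of high
frequency: hence the sum is `T = f + ĝ` for two measurable functions `f`, `g` bounded by `1`, and no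
convergence problem arises. The countable set is chosen dense in each of the three strata of `Γ`
(bounded position, bounded frequency, both at infinity), so that each point of `Γ` is approached by
centers coming from its own stratum.

* **`WF(T) ⊆ Γ`.** Let `m` and `κ` be cut-offs near the two components of a point outside of `Γ`:
  bump functions, or asymptotic cut-offs `ψ_R`. Both are symbols of order `0` (`IsSymbol`), so that
  multiplication of a packet by `m` changes its profile in a uniformly bounded way. As the centers
  stay away from the support of `m` or from that of `κ`, the Schwartz seminorms of `κ · F(m ·
  packet)` are rapidly decreasing in `s_k` (`exists_schwartzNorm_localize_packet_le`). The series of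
  these functions converges in the Schwartz space, and `κ · F(m · T)` is a Schwartz function
  (`PacketFamily.exists_localize_distr_eq`). This excludes the point from the wave front set in all
  of the cases of its definition (`PacketFamily.notMem_globalWF_distr`).
* **`Γ ⊆ WF(T)`.** If a point of `Γ` were not in the wave front set, then the pairings of `T` with
  test functions centered at the packets which tend to this point, cut off by symbols, would tend to
  `0`. But on bounded sets around its center, the `k`-th packet tends to a pure phase, and the
  symbols tend to their nonzero values at the point; the remaining packets contribute nothing, by
  the lacunarity and the Riemann-Lebesgue lemma, and the pairings tend to a nonzero constant, by
  Fourier inversion. The three strata are treated in `PacketFamily.mem_globalWF_of_highFreq`,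
  `PacketFamily.mem_globalWF_of_farOut` and `PacketFamily.mem_globalWF_of_corner`.

The packets do not depend on the cut-off `φ`, and neither does `T`. -/

namespace GlobalWF

variable {d : ℕ}

local notation "𝔼" => EuclideanSpace ℝ (Fin d)

/-! ### Plane waves, phase space shifts and the Fourier transform -/

theorem planeWave_comm (ξ x : 𝔼) : planeWave ξ x = planeWave x ξ := by
  simp [planeWave, real_inner_comm]

@[simp]
theorem norm_planeWave (ξ x : 𝔼) : ‖planeWave ξ x‖ = 1 := by
  have : -Complex.I * ((inner ℝ x ξ : ℝ) : ℂ) = ((-inner ℝ x ξ : ℝ) : ℂ) * Complex.I := by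
    push_cast; ring
  rw [planeWave, this, Complex.norm_exp_ofReal_mul_I]

theorem planeWave_add_left (ξ η x : 𝔼) :
    planeWave (ξ + η) x = planeWave ξ x * planeWave η x := by
  simp only [planeWave, ← Complex.exp_add, inner_add_right]
  congr 1; push_cast; ring

theorem planeWave_add_right (ξ x y : 𝔼) :
    planeWave ξ (x + y) = planeWave ξ x * planeWave ξ y := by
  rw [planeWave_comm, planeWave_add_left, planeWave_comm x, planeWave_comm y]

@[simp]
theorem planeWave_zero_left (x : 𝔼) : planeWave 0 x = 1 := by
  simp [planeWave]

@[simp]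
theorem planeWave_zero_right (x : 𝔼) : planeWave x 0 = 1 := by
  simp [planeWave]

theorem planeWave_neg_mul (ξ x : 𝔼) : planeWave (-ξ) x * planeWave ξ x = 1 := by
  rw [← planeWave_add_left]; simp

theorem planeWave_mul_neg (ξ x : 𝔼) : planeWave ξ x * planeWave (-ξ) x = 1 := by
  rw [← planeWave_add_left]; simp

@[fun_prop]
theorem continuous_planeWave (ξ : 𝔼) : Continuous (planeWave ξ) :=
  (planeWave_hasTemperateGrowth ξ).1.continuous

/-- The phase space shift `f ↦ exp(i ⟨·, ξ₀⟩) f(· - x₀)`, which moves a function from the point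
`(0, 0)` of phase space to the point `(x₀, ξ₀)`. -/
noncomputable def phaseShift (x₀ ξ₀ : 𝔼) : 𝓢(𝔼, ℂ) →L[ℂ] 𝓢(𝔼, ℂ) :=
  SchwartzMap.smulLeftCLM ℂ (planeWave (-ξ₀)) ∘L SchwartzMap.compSubConstCLM ℂ x₀

theorem phaseShift_apply (x₀ ξ₀ : 𝔼) (f : 𝓢(𝔼, ℂ)) (x : 𝔼) :
    phaseShift x₀ ξ₀ f x = planeWave (-ξ₀) x * f (x - x₀) := by
  simp [phaseShift, SchwartzMap.smulLeftCLM_apply_apply (planeWave_hasTemperateGrowth _)]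

/-- The dilation `f ↦ f(c ·)`. -/
noncomputable def dilation (c : ℝˣ) : 𝓢(𝔼, ℂ) →L[ℂ] 𝓢(𝔼, ℂ) :=
  SchwartzMap.compCLMOfContinuousLinearEquiv ℂ (ContinuousLinearEquiv.smulLeft c)

theorem dilation_apply (c : ℝˣ) (f : 𝓢(𝔼, ℂ)) (x : 𝔼) :
    dilation c f x = f ((c : ℝ) • x) := rfl

/-- The Fourier transform turns a shift by `(x₀, ξ₀)` into a shift by `(ξ₀, -x₀)`. -/
theorem fourierSchwartz_phaseShift (x₀ ξ₀ : 𝔼) (f : 𝓢(𝔼, ℂ)) :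
    fourierSchwartz d (phaseShift x₀ ξ₀ f) =
      planeWave (-x₀) ξ₀ • phaseShift ξ₀ (-x₀) (fourierSchwartz d f) := by
  ext ξ
  rw [smul_apply, phaseShift_apply, fourierSchwartz_apply, fourierSchwartz_apply,
    ← integral_add_right_eq_self _ x₀, neg_neg, smul_eq_mul, ← integral_const_mul,
    ← integral_const_mul]
  refine integral_congr_ae (.of_forall fun x => ?_)
  simp only [phaseShift_apply, add_sub_cancel_right, ← mul_assoc]
  congr 1
  simp only [planeWave, ← Complex.exp_add]
  congr 1
  simp only [inner_add_left, inner_sub_right, inner_neg_right,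
    real_inner_comm x₀ ξ₀, real_inner_comm x₀ ξ]
  push_cast; ring

theorem fourierSchwartz_dilation (c : ℝˣ) (f : 𝓢(𝔼, ℂ)) :
    fourierSchwartz d (dilation c f) =
      ((|(c : ℝ) ^ d|⁻¹ : ℝ) : ℂ) • dilation c⁻¹ (fourierSchwartz d f) := by
  ext ξ
  rw [smul_apply, dilation_apply, fourierSchwartz_apply, fourierSchwartz_apply]
  have := Measure.integral_comp_smul (μ := (volume : Measure 𝔼))
    (fun x => planeWave (((c⁻¹ : ℝˣ) : ℝ) • ξ) x * f x) c
  rw [finrank_euclideanSpace_fin, abs_inv] at this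
  simp only [smul_eq_mul, ← Complex.real_smul]
  rw [← this]
  refine integral_congr_ae (.of_forall fun x => ?_)
  simp only [dilation_apply, planeWave, inner_smul_left, inner_smul_right]
  simp

/-- The plane wave in terms of the additive character used by Mathlib's Fourier transform. -/
theorem planeWave_eq_fourierChar (ξ x : 𝔼) :
    planeWave ξ x = (Real.fourierChar (-(inner ℝ x ((2 * Real.pi)⁻¹ • ξ))) : ℂ) := by
  rw [Real.fourierChar_apply, planeWave, inner_smul_right]
  have : (Real.pi : ℂ) ≠ 0 := by exact_mod_cast Real.pi_ne_zero
  congr 1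
  push_cast
  field_simp

/-- The Riemann-Lebesgue lemma, for the kernel `exp(-i ⟨x, ξ⟩)`. -/
theorem tendsto_integral_planeWave_mul (f : 𝔼 → ℂ) :
    Filter.Tendsto (fun ξ : 𝔼 => ∫ x, planeWave ξ x * f x) (Filter.cocompact 𝔼) (𝓝 0) := by
  have h1 := tendsto_integral_exp_inner_smul_cocompact f
  have h2 : Filter.Tendsto (fun ξ : 𝔼 => (2 * Real.pi)⁻¹ • ξ)
      (Filter.cocompact 𝔼) (Filter.cocompact 𝔼) :=
    (Homeomorph.smulOfNeZero ((2 * Real.pi)⁻¹ : ℝ)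
      (by positivity)).isClosedEmbedding.tendsto_cocompact
  refine (h1.comp h2).congr fun ξ => ?_
  refine integral_congr_ae (.of_forall fun x => ?_)
  simp only [planeWave_eq_fourierChar, Circle.smul_def, smul_eq_mul]

theorem integral_fourierSchwartz_mul (f g : 𝓢(𝔼, ℂ)) :
    ∫ ξ, fourierSchwartz d f ξ * g ξ = ∫ x, f x * fourierSchwartz d g x := by
  let L : 𝔼 →ₗ[ℝ] 𝔼 →ₗ[ℝ] ℝ := ((2 * Real.pi)⁻¹ : ℝ) • innerₗ 𝔼
  have h := VectorFourier.integral_fourierIntegral_smul_eq_flip (e := Real.fourierChar)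
    (L := L) (μ := (volume : Measure 𝔼)) (ν := (volume : Measure 𝔼)) (f := f) (g := g)
    Real.continuous_fourierChar
    (by simp only [L, LinearMap.smul_apply, innerₗ_apply_apply]; fun_prop)
    f.integrable g.integrable
  have e1 : ∀ (f : 𝓢(𝔼, ℂ)) ξ, fourierSchwartz d f ξ =
      VectorFourier.fourierIntegral Real.fourierChar volume L f ξ := by
    intro f ξ
    rw [fourierSchwartz_apply]
    refine integral_congr_ae (.of_forall fun x => ?_)
    simp [planeWave_eq_fourierChar, L, Circle.smul_def, inner_smul_right]
  have e2 : L.flip = L := by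
    ext x y; simp [L, real_inner_comm]
  rw [e2] at h
  simpa only [e1, smul_eq_mul] using h

/-- Fourier inversion: `∫ exp(i ⟨x, ξ⟩) f̂(ξ) dξ = (2π)^d f(x)`. -/
theorem integral_planeWave_mul_fourierSchwartz (f : 𝓢(𝔼, ℂ)) (x : 𝔼) :
    ∫ ξ, planeWave (-x) ξ * fourierSchwartz d f ξ = ((2 * Real.pi) ^ d : ℝ) * f x := by
  have h := Measure.integral_comp_smul (μ := (volume : Measure 𝔼))
    (fun ξ => planeWave (-x) ((2 * Real.pi) • ξ) * FourierTransform.fourier f ξ)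
    ((2 * Real.pi)⁻¹)
  have hpi : (2 * Real.pi) ≠ 0 := by positivity
  simp only [smul_inv_smul₀ hpi] at h
  rw [finrank_euclideanSpace_fin] at h
  have h2 : (∫ ξ, planeWave (-x) ((2 * Real.pi) • ξ) * FourierTransform.fourier f ξ) = f x := by
    have : FourierTransformInv.fourierInv (FourierTransform.fourier f) x = f x := by
      rw [FourierTransform.fourierInv_fourier_eq]
    rw [SchwartzMap.fourierInv_coe, Real.fourierInv_eq'] at this
    rw [← this]
    refine integral_congr_ae (.of_forall fun ξ => ?_)
    simp only [planeWave, smul_eq_mul, inner_smul_left, inner_neg_right]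
    congr 2
    push_cast
    simp
    ring
  rw [h2] at h
  rw [show (((2 * Real.pi) ^ d : ℝ) : ℂ) * f x = |(((2 * Real.pi)⁻¹) ^ d)⁻¹| • f x by
    rw [abs_of_pos (by positivity), inv_pow, inv_inv, Complex.real_smul], ← h]
  rfl

/-! ### Symbols of order zero -/

/-- Symbols of order `0` on `ℝ^d`: the `n`-th derivative is `O((1 + |x|)^(-n))`. -/
structure IsSymbol (m : 𝔼 → ℂ) : Prop where
  contDiff : ContDiff ℝ ∞ m
  bound : ∀ n : ℕ, ∃ C : ℝ, ∀ x : 𝔼, (1 + ‖x‖) ^ n * ‖iteratedFDeriv ℝ n m x‖ ≤ C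

namespace IsSymbol

theorem exists_bound {m : 𝔼 → ℂ} (hm : IsSymbol m) (n : ℕ) : ∃ C : ℝ, 0 ≤ C ∧ ∀ i ≤ n, ∀ x : 𝔼,
    (1 + ‖x‖) ^ i * ‖iteratedFDeriv ℝ i m x‖ ≤ C := by
  choose C hC using hm.bound
  have h0 : ∀ i, 0 ≤ C i := fun i => by
    have h : 0 ≤ (1 + ‖(0 : 𝔼)‖) ^ i * ‖iteratedFDeriv ℝ i m 0‖ := by positivity
    exact h.trans (hC i 0)
  refine ⟨∑ i ∈ Finset.range (n + 1), C i, Finset.sum_nonneg fun i _ => h0 i, fun i hi x => ?_⟩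
  exact (hC i x).trans (Finset.single_le_sum (f := C) (fun i _ => h0 i)
    (Finset.mem_range.2 (Nat.lt_succ_of_le hi)))

theorem exists_bound_iteratedFDeriv {m : 𝔼 → ℂ} (hm : IsSymbol m) (n : ℕ) :
    ∃ C : ℝ, 0 ≤ C ∧ ∀ i ≤ n, ∀ x : 𝔼, ‖iteratedFDeriv ℝ i m x‖ ≤ C := by
  obtain ⟨C, hC0, hC⟩ := hm.exists_bound n
  refine ⟨C, hC0, fun i hi x => le_trans ?_ (hC i hi x)⟩
  have h1 : (1 : ℝ) ≤ (1 + ‖x‖) ^ i := one_le_pow₀ (le_add_of_nonneg_right (norm_nonneg x))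
  exact le_mul_of_one_le_left (norm_nonneg _) h1

theorem hasTemperateGrowth {m : 𝔼 → ℂ} (hm : IsSymbol m) : m.HasTemperateGrowth := by
  refine ⟨hm.contDiff, fun n => ?_⟩
  obtain ⟨C, -, hC⟩ := hm.exists_bound_iteratedFDeriv n
  exact ⟨0, C, fun x => by simpa using hC n le_rfl x⟩

end IsSymbol

theorem isSymbol_of_hasCompactSupport {m : 𝔼 → ℂ} (hm : ContDiff ℝ ∞ m)
    (hs : HasCompactSupport m) : IsSymbol m := by
  refine ⟨hm, fun n => ?_⟩
  have hn : ((n : ℕ∞) : WithTop ℕ∞) ≤ ∞ := mod_cast le_top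
  have hc : Continuous fun x : 𝔼 => (1 + ‖x‖) ^ n * ‖iteratedFDeriv ℝ n m x‖ :=
    (by fun_prop : Continuous fun x : 𝔼 => (1 + ‖x‖) ^ n).mul
      (hm.continuous_iteratedFDeriv hn).norm
  obtain ⟨C, hC⟩ := hc.bounded_above_of_compact_support
    ((hs.iteratedFDeriv (𝕜 := ℝ) n).norm.mul_left)
  exact ⟨C, fun x => (le_abs_self _).trans (hC x)⟩

/-- Asymptotic cut-offs are symbols of order `0`: away from a compact set, they are positively
homogeneous of degree `0`. -/
theorem isSymbol_asympCutoff {φ ψ : 𝔼 → ℂ} (hφ : IsCutoff φ) (hψ : IsAngular ψ) {R : ℝ}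
    (hR : 0 < R) : IsSymbol (asympCutoff φ ψ R) := by
  have hsm := (asympCutoff_hasTemperateGrowth hφ hψ hR).1
  refine ⟨hsm, fun n => ?_⟩
  have hn : ((n : ℕ∞) : WithTop ℕ∞) ≤ ∞ := mod_cast le_top
  obtain ⟨r, hr⟩ := hφ.hasCompactSupport.isCompact.isBounded.subset_closedBall 0
  set ρ : ℝ := max 1 (R * r) with hρ
  obtain ⟨M, hM⟩ := (isCompact_sphere (0 : 𝔼) (1 : ℝ)).exists_bound_of_continuousOn
    (f := iteratedFDeriv ℝ n ψ) (by
      have := hψ.contDiffOn.continuousOn_iteratedFDerivWithin hn isOpen_compl_singleton.uniqueDiffOn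
      have h' : ContinuousOn (iteratedFDeriv ℝ n ψ) {0}ᶜ :=
        this.congr fun x hx => (iteratedFDerivWithin_of_isOpen n isOpen_compl_singleton hx).symm
      refine h'.mono fun x hx => ?_
      rintro rfl
      simp at hx)
  obtain ⟨M', hM'⟩ := (isCompact_closedBall (0 : 𝔼) ρ).exists_bound_of_continuousOn
    (f := fun x => (1 + ‖x‖) ^ n • iteratedFDeriv ℝ n (asympCutoff φ ψ R) x) (by
      have := hsm.continuous_iteratedFDeriv hn
      fun_prop)
  refine ⟨max (2 ^ n * M) M', fun x => ?_⟩
  by_cases hx : ‖x‖ ≤ ρ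
  · have := hM' x (by simpa using hx)
    rw [norm_smul, norm_pow, Real.norm_of_nonneg (by positivity)] at this
    exact this.trans (le_max_right _ _)
  · push Not at hx
    have hx1 : 1 < ‖x‖ := (le_max_left _ _).trans_lt hx
    have hx0 : x ≠ 0 := by
      rintro rfl
      simp at hx1
      linarith
    have e1 : asympCutoff φ ψ R =ᶠ[𝓝 x] ψ := by
      filter_upwards [(isOpen_lt continuous_const continuous_norm).mem_nhds hx] with y hy
      have hy' : ρ < ‖y‖ := hy
      have hz : φ (R⁻¹ • y) = 0 := by
        by_contra hne
        have := hr (subset_tsupport _ (Function.mem_support.2 hne))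
        rw [mem_closedBall_zero_iff, norm_smul, norm_inv, Real.norm_of_nonneg hR.le,
          inv_mul_le_iff₀ hR] at this
        have := (le_max_right 1 (R * r)).trans_lt hy'
        linarith
      simp [asympCutoff, hz]
    rw [(Filter.EventuallyEq.iteratedFDeriv ℝ e1 n).eq_of_nhds]
    have ht : (‖x‖⁻¹ : ℝ) ≠ 0 := by positivity
    let g : 𝔼 ≃L[ℝ] 𝔼 := ContinuousLinearEquiv.smulLeft (Units.mk0 (‖x‖⁻¹ : ℝ) ht)
    have hg : ∀ y, g y = ‖x‖⁻¹ • y := fun y => rfl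
    have e2 : ψ =ᶠ[𝓝 x] ψ ∘ g := by
      filter_upwards [isOpen_compl_singleton.mem_nhds hx0] with y hy
      simp only [Function.comp, hg]
      exact (hψ.homogeneous _ (by positivity) y hy).symm
    have e3 : iteratedFDeriv ℝ n (ψ ∘ g) x =
        (iteratedFDeriv ℝ n ψ (g x)).compContinuousLinearMap (fun _ => (g : _ →L[ℝ] _)) := by
      have := g.iteratedFDerivWithin_comp_right ψ uniqueDiffOn_univ (x := x) (mem_univ _) n
      simpa [iteratedFDerivWithin_univ] using this
    rw [(Filter.EventuallyEq.iteratedFDeriv ℝ e2 n).eq_of_nhds, e3]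
    have hgn : ‖(g : 𝔼 →L[ℝ] 𝔼)‖ ≤ ‖x‖⁻¹ := by
      refine ContinuousLinearMap.opNorm_le_bound _ (by positivity) fun y => ?_
      rw [ContinuousLinearEquiv.coe_coe, hg, norm_smul, norm_inv, norm_norm]
    have hgx : ‖iteratedFDeriv ℝ n ψ (g x)‖ ≤ M := by
      apply hM
      rw [mem_sphere_zero_iff_norm, hg, norm_smul, norm_inv, norm_norm]
      exact inv_mul_cancel₀ (by positivity)
    have hM0 : 0 ≤ M := (norm_nonneg _).trans hgx
    refine le_trans ?_ (le_max_left _ _)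
    calc (1 + ‖x‖) ^ n * _ ≤ (1 + ‖x‖) ^ n * (‖iteratedFDeriv ℝ n ψ (g x)‖ * ∏ _i : Fin n,
          ‖(g : 𝔼 →L[ℝ] 𝔼)‖) := by
          gcongr
          exact ContinuousMultilinearMap.norm_compContinuousLinearMap_le _ _
      _ ≤ (2 * ‖x‖) ^ n * (M * (‖x‖⁻¹) ^ n) := by
          rw [Finset.prod_const, Finset.card_univ, Fintype.card_fin]
          gcongr
          linarith
      _ = 2 ^ n * M * (‖x‖ * ‖x‖⁻¹) ^ n := by rw [mul_pow, mul_pow]; ring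
      _ = 2 ^ n * M := by rw [mul_inv_cancel₀ (by positivity), one_pow, mul_one]

/-- The asymptotic cut-off `ψ_R` tends to `ψ(θ)` at infinity in the direction `θ`. -/
theorem tendsto_asympCutoff {φ ψ : 𝔼 → ℂ} (hφ : IsCutoff φ) (hψ : IsAngular ψ) {R : ℝ}
    (hR : 0 < R) {ι : Type*} {l : Filter ι} {t : ι → ℝ} {w : ι → 𝔼} {θ : 𝔼} (hθ : ‖θ‖ = 1)
    (ht : Filter.Tendsto t l Filter.atTop) (hw : Filter.Tendsto w l (𝓝 θ)) :
    Filter.Tendsto (fun k => asympCutoff φ ψ R (t k • w k)) l (𝓝 (ψ θ)) := by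
  have hθ0 : θ ≠ 0 := by rintro rfl; simp at hθ
  have hψc : ContinuousAt ψ θ :=
    hψ.contDiffOn.continuousOn.continuousAt (isOpen_compl_singleton.mem_nhds hθ0)
  refine (hψc.tendsto.comp hw).congr' ?_
  obtain ⟨r, hr⟩ := hφ.hasCompactSupport.isCompact.isBounded.subset_closedBall 0
  have hnw : Filter.Tendsto (fun k => ‖w k‖) l (𝓝 1) := hθ ▸ hw.norm
  filter_upwards [ht.eventually_gt_atTop (max 0 (2 * (R * r))),
    hnw.eventually (lt_mem_nhds (show (1 / 2 : ℝ) < 1 by norm_num)),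
    hw.eventually (isOpen_compl_singleton.mem_nhds hθ0)] with k h1 h2 h3
  have hk : 0 < t k := (le_max_left _ _).trans_lt h1
  have hk' : 2 * (R * r) < t k := (le_max_right _ _).trans_lt h1
  have hz : φ (R⁻¹ • t k • w k) = 0 := by
    by_contra hne
    have := hr (subset_tsupport _ (Function.mem_support.2 hne))
    rw [mem_closedBall_zero_iff, norm_smul, norm_smul, norm_inv, Real.norm_of_nonneg hR.le,
      Real.norm_of_nonneg hk.le, inv_mul_le_iff₀ hR] at this
    nlinarith
  simp [asympCutoff, hz, hψ.homogeneous _ hk _ h3]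

/-! ### Products of symbols and Schwartz functions -/

theorem seminorm_smulLeftCLM_le {h : 𝔼 → ℂ} (hh : h.HasTemperateGrowth) {A : ℝ} (p n l : ℕ)
    (hA : ∀ i ≤ n, ∀ z : 𝔼, ‖iteratedFDeriv ℝ i h z‖ ≤ A * (1 + ‖z‖) ^ l) (g : 𝓢(𝔼, ℂ)) :
    SchwartzMap.seminorm ℂ p n (SchwartzMap.smulLeftCLM ℂ h g) ≤
      A * (2 ^ n * 2 ^ (p + l) *
        (Finset.Iic (p + l, n)).sup (schwartzSeminormFamily ℂ 𝔼 ℂ) g) := by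
  have hA0 : 0 ≤ A := by
    have := (norm_nonneg _).trans (hA 0 (Nat.zero_le _) 0)
    simpa using this
  refine SchwartzMap.seminorm_le_bound ℂ p n _ (by positivity) fun x => ?_
  have hcoe : ⇑(SchwartzMap.smulLeftCLM ℂ h g) = fun y => h y * g y := by
    ext y; simp [SchwartzMap.smulLeftCLM_apply_apply hh]
  rw [hcoe]
  set S := (Finset.Iic (p + l, n)).sup (schwartzSeminormFamily ℂ 𝔼 ℂ) g
  have hle := norm_iteratedFDeriv_mul_le (N := ∞) hh.1 (g.smooth ⊤) x (n := n) (mod_cast le_top)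
  calc ‖x‖ ^ p * _ ≤ ‖x‖ ^ p * _ := mul_le_mul_of_nonneg_left hle (by positivity)
    _ ≤ ‖x‖ ^ p * ∑ i ∈ Finset.range (n + 1), (n.choose i : ℝ) * (A * (1 + ‖x‖) ^ l) *
        ‖iteratedFDeriv ℝ (n - i) g x‖ := by
      refine mul_le_mul_of_nonneg_left (Finset.sum_le_sum fun i hi => ?_) (by positivity)
      have := hA i (by simpa [Nat.lt_succ_iff] using hi) x
      gcongr
    _ ≤ ∑ i ∈ Finset.range (n + 1), (n.choose i : ℝ) * (A * (2 ^ (p + l) * S)) := by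
      rw [Finset.mul_sum]
      refine Finset.sum_le_sum fun i _ => ?_
      have h1 := SchwartzMap.one_add_le_sup_seminorm_apply (𝕜 := ℂ) (m := (p + l, n)) le_rfl
        (Nat.sub_le n i) g x
      have h2 : ‖x‖ ^ p ≤ (1 + ‖x‖) ^ p := by gcongr; linarith
      calc _ = (n.choose i : ℝ) * (A * (‖x‖ ^ p * (1 + ‖x‖) ^ l *
            ‖iteratedFDeriv ℝ (n - i) g x‖)) := by ring
        _ ≤ (n.choose i : ℝ) * (A * ((1 + ‖x‖) ^ p * (1 + ‖x‖) ^ l *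
            ‖iteratedFDeriv ℝ (n - i) g x‖)) := by gcongr
        _ ≤ _ := by
          rw [← pow_add]
          exact mul_le_mul_of_nonneg_left (mul_le_mul_of_nonneg_left h1 hA0) (by positivity)
    _ = A * (2 ^ n * 2 ^ (p + l) * S) := by
      rw [← Finset.sum_mul]
      have : ∑ i ∈ Finset.range (n + 1), (n.choose i : ℝ) = 2 ^ n := by
        exact_mod_cast Nat.sum_range_choose n
      rw [this]; ring

theorem hasTemperateGrowth_comp_affine {m : 𝔼 → ℂ} (hm : m.HasTemperateGrowth) (x₀ : 𝔼) (c : ℝ) :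
    Function.HasTemperateGrowth fun z : 𝔼 => m (x₀ + c • z) := by
  have h : Function.HasTemperateGrowth fun z : 𝔼 => x₀ + c • z :=
    (Function.HasTemperateGrowth.const x₀).add
      ((c • ContinuousLinearMap.id ℝ 𝔼).hasTemperateGrowth)
  exact hm.comp h

theorem iteratedFDeriv_comp_affine {m : 𝔼 → ℂ} (hm : ContDiff ℝ ∞ m) (x₀ : 𝔼) (c : ℝ) (i : ℕ)
    (z : 𝔼) : iteratedFDeriv ℝ i (fun z : 𝔼 => m (x₀ + c • z)) z =
      c ^ i • iteratedFDeriv ℝ i m (x₀ + c • z) := by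
  have h1 : ContDiff ℝ i (fun y => m (x₀ + y)) :=
    (hm.of_le (mod_cast le_top)).comp (contDiff_const.add contDiff_id)
  have := congr_fun (iteratedFDeriv_comp_const_smul c h1) z
  rw [this, iteratedFDeriv_comp_add_left]

/-- Multiplying a packet at `x₀` of width `c ≤ (1 + |x₀|)^(1/2)` by a symbol amounts to multiplying
its profile by `z ↦ m(x₀ + c z)`, whose derivatives are polynomially bounded uniformly in `x₀` and
`c`. -/
theorem IsSymbol.norm_iteratedFDeriv_comp_affine_le {m : 𝔼 → ℂ} (hm : IsSymbol m) (n : ℕ) :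
    ∃ C : ℝ, 0 ≤ C ∧ ∀ (x₀ : 𝔼) (c : ℝ), 0 < c → c ^ 2 ≤ 1 + ‖x₀‖ → ∀ i ≤ n, ∀ z : 𝔼,
      ‖iteratedFDeriv ℝ i (fun z : 𝔼 => m (x₀ + c • z)) z‖ ≤ C * (1 + ‖z‖) ^ n := by
  obtain ⟨C, hC0, hC⟩ := hm.exists_bound n
  refine ⟨C, hC0, fun x₀ c hc hcx i hi z => ?_⟩
  rw [iteratedFDeriv_comp_affine hm.contDiff, norm_smul, norm_pow, Real.norm_of_nonneg hc.le]
  have hz : 0 ≤ ‖z‖ := norm_nonneg z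
  have hy : 0 ≤ ‖x₀ + c • z‖ := norm_nonneg _
  have key : c ≤ (1 + ‖z‖) * (1 + ‖x₀ + c • z‖) := by
    rcases le_total c 1 with h | h
    · nlinarith [mul_nonneg hz hy]
    · have h1 : ‖x₀‖ ≤ ‖x₀ + c • z‖ + c * ‖z‖ := by
        calc ‖x₀‖ = ‖(x₀ + c • z) - c • z‖ := by simp
          _ ≤ _ := norm_sub_le _ _
          _ = _ := by rw [norm_smul, Real.norm_of_nonneg hc.le]
      have h2 : c ^ 2 ≤ c * ((1 + ‖z‖) * (1 + ‖x₀ + c • z‖)) := by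
        nlinarith [mul_nonneg hz hy, mul_nonneg hc.le (mul_nonneg hz hy),
          mul_nonneg (sub_nonneg.2 h) hy]
      nlinarith
  calc c ^ i * ‖iteratedFDeriv ℝ i m (x₀ + c • z)‖
      ≤ ((1 + ‖z‖) * (1 + ‖x₀ + c • z‖)) ^ i * ‖iteratedFDeriv ℝ i m (x₀ + c • z)‖ := by gcongr
    _ = (1 + ‖z‖) ^ i * ((1 + ‖x₀ + c • z‖) ^ i * ‖iteratedFDeriv ℝ i m (x₀ + c • z)‖) := by
      rw [mul_pow]; ring
    _ ≤ (1 + ‖z‖) ^ n * C := by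
      gcongr
      · linarith
      · exact hC i hi _
    _ = _ := mul_comm _ _

/-- Seen from a point `x₀` far away, a symbol `m` is close to the constant `m(x₀)`. -/
theorem IsSymbol.norm_iteratedFDeriv_sub_le {m : 𝔼 → ℂ} (hm : IsSymbol m) (n : ℕ) :
    ∃ C : ℝ, 0 ≤ C ∧ ∀ (x₀ : 𝔼), ∀ i ≤ n, ∀ z : 𝔼,
      ‖iteratedFDeriv ℝ i (fun z : 𝔼 => m (x₀ + z) - m x₀) z‖ ≤
        C / (1 + ‖x₀‖) * (1 + ‖z‖) ^ 1 := by
  obtain ⟨C, hC0, hC⟩ := hm.exists_bound (n + 1)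
  refine ⟨4 * C, by positivity, fun x₀ i hi z => ?_⟩
  have hx : 0 < 1 + ‖x₀‖ := by positivity
  rw [pow_one, div_mul_eq_mul_div, le_div_iff₀ hx]
  have htri : 1 + ‖x₀‖ ≤ (1 + ‖x₀ + z‖) * (1 + ‖z‖) := by
    have : ‖x₀‖ ≤ ‖x₀ + z‖ + ‖z‖ := by simpa using norm_sub_le (x₀ + z) z
    nlinarith [norm_nonneg (x₀ + z), norm_nonneg z,
      mul_nonneg (norm_nonneg (x₀ + z)) (norm_nonneg z)]
  rcases Nat.eq_zero_or_pos i with rfl | hi0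
  · rw [norm_iteratedFDeriv_zero]
    have hb : ∀ y, ‖m y‖ ≤ C := fun y => by simpa using hC 0 (Nat.zero_le _) y
    by_cases hz : 2 * ‖z‖ ≤ 1 + ‖x₀‖
    · have hd : ∀ y ∈ closedBall x₀ ‖z‖, ‖fderiv ℝ m y‖ ≤ 2 * C / (1 + ‖x₀‖) := by
        intro y hy
        rw [le_div_iff₀ hx]
        have h1 : ‖x₀‖ ≤ ‖y‖ + ‖z‖ := by
          have : ‖x₀‖ ≤ ‖y‖ + ‖y - x₀‖ := by simpa using norm_sub_le y (y - x₀)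
          rw [mem_closedBall, dist_eq_norm] at hy
          linarith
        have h2 := hC 1 (by omega) y
        rw [norm_iteratedFDeriv_one, pow_one] at h2
        nlinarith [norm_nonneg (fderiv ℝ m y)]
      have := (convex_closedBall x₀ ‖z‖).norm_image_sub_le_of_norm_fderiv_le
        (fun y _ => (hm.contDiff.differentiable (by simp)).differentiableAt) hd
        (mem_closedBall_self (norm_nonneg z)) (y := x₀ + z) (by simp)
      rw [add_sub_cancel_left, div_mul_eq_mul_div, le_div_iff₀ hx] at this
      nlinarith [norm_nonneg z]
    · have h1 := norm_sub_le (m (x₀ + z)) (m x₀)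
      have h2 := hb (x₀ + z)
      have h3 := hb x₀
      push Not at hz
      calc _ ≤ (2 * C) * (1 + ‖x₀‖) := by gcongr; linarith
        _ ≤ (2 * C) * (2 * (1 + ‖z‖)) := by gcongr; linarith
        _ = _ := by ring
  · have e : iteratedFDeriv ℝ i (fun z : 𝔼 => m (x₀ + z) - m x₀) z =
        iteratedFDeriv ℝ i m (x₀ + z) := by
      have h1 : ContDiff ℝ i (fun y => m (x₀ + y)) :=
        (hm.contDiff.of_le (mod_cast le_top)).comp (contDiff_const.add contDiff_id)
      have := iteratedFDeriv_sub_apply (x := z) h1.contDiffAt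
        (contDiff_const (c := m x₀)).contDiffAt
      rw [show (fun z : 𝔼 => m (x₀ + z) - m x₀) = (fun y => m (x₀ + y)) - fun _ => m x₀ from rfl,
        this, iteratedFDeriv_comp_add_left, iteratedFDeriv_const_of_ne (by omega)]
      simp
    rw [e]
    have h2 := hC i (by omega) (x₀ + z)
    have h3 : (1 + ‖x₀ + z‖) ≤ (1 + ‖x₀ + z‖) ^ i :=
      le_self_pow₀ (by linarith [norm_nonneg (x₀ + z)]) (by omega)
    calc _ ≤ ‖iteratedFDeriv ℝ i m (x₀ + z)‖ * ((1 + ‖x₀ + z‖) ^ i * (1 + ‖z‖)) := by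
          gcongr
          exact htri.trans (by gcongr)
      _ = ((1 + ‖x₀ + z‖) ^ i * ‖iteratedFDeriv ℝ i m (x₀ + z)‖) * (1 + ‖z‖) := by ring
      _ ≤ C * (1 + ‖z‖) := by gcongr
      _ ≤ _ := by nlinarith [norm_nonneg z]

/-- If `x₀ → ∞` and `m(x₀) → a` for a symbol `m`, then the multiplications by `m(x₀ + ·)` tend to
the multiplication by `a`, on convergent sequences of Schwartz functions. -/
theorem IsSymbol.tendsto_smulLeftCLM {m : 𝔼 → ℂ} (hm : IsSymbol m) {ι : Type*} {l : Filter ι}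
    {x : ι → 𝔼} {a : ℂ} (hx : Filter.Tendsto (fun k => ‖x k‖) l Filter.atTop)
    (ha : Filter.Tendsto (fun k => m (x k)) l (𝓝 a)) {g : ι → 𝓢(𝔼, ℂ)} {g₀ : 𝓢(𝔼, ℂ)}
    (hg : Filter.Tendsto g l (𝓝 g₀)) :
    Filter.Tendsto (fun k => SchwartzMap.smulLeftCLM ℂ (fun z => m (x k + z)) (g k)) l
      (𝓝 (a • g₀)) := by
  have hT : ∀ x₀, Function.HasTemperateGrowth fun z : 𝔼 => m (x₀ + z) - m x₀ := fun x₀ => by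
    have := hasTemperateGrowth_comp_affine hm.hasTemperateGrowth x₀ 1
    simp only [one_smul] at this
    exact this.sub (Function.HasTemperateGrowth.const _)
  have hsplit : ∀ k, SchwartzMap.smulLeftCLM ℂ (fun z => m (x k + z)) (g k) =
      SchwartzMap.smulLeftCLM ℂ (fun z => m (x k + z) - m (x k)) (g k) + m (x k) • g k := by
    intro k
    have := hasTemperateGrowth_comp_affine hm.hasTemperateGrowth (x k) 1
    simp only [one_smul] at this
    ext z
    simp [SchwartzMap.smulLeftCLM_apply_apply this, SchwartzMap.smulLeftCLM_apply_apply (hT _),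
      sub_mul]
  simp only [hsplit]
  rw [show a • g₀ = 0 + a • g₀ by simp]
  refine Filter.Tendsto.add ?_ (ha.smul hg)
  rw [(schwartz_withSeminorms ℂ 𝔼 ℂ).tendsto_nhds]
  rintro ⟨p, n⟩ ε hε
  obtain ⟨C, hC0, hC⟩ := hm.norm_iteratedFDeriv_sub_le n
  set q : Seminorm ℂ 𝓢(𝔼, ℂ) := (Finset.Iic (p + 1, n)).sup (schwartzSeminormFamily ℂ 𝔼 ℂ)
  have hq : ∀ᶠ k in l, q (g k) ≤ q g₀ + 1 := by
    filter_upwards [((schwartz_withSeminorms ℂ 𝔼 ℂ).tendsto_nhds' g g₀).1 hg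
      (Finset.Iic (p + 1, n)) 1 one_pos] with k hk
    have h1 := map_add_le_add q (g k - g₀) g₀
    rw [sub_add_cancel] at h1
    have h2 : q (g k - g₀) < 1 := hk
    linarith
  have hlim : Filter.Tendsto (fun k => C / (1 + ‖x k‖) * (2 ^ n * 2 ^ (p + 1) * (q g₀ + 1))) l
      (𝓝 (0 * (2 ^ n * 2 ^ (p + 1) * (q g₀ + 1)))) :=
    ((Filter.tendsto_atTop_add_const_left _ _ hx).const_div_atTop C).mul_const _
  rw [zero_mul] at hlim
  filter_upwards [hlim.eventually (gt_mem_nhds hε), hq] with k hk hk'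
  rw [sub_zero]
  refine ((seminorm_smulLeftCLM_le (hT _) p n 1 (hC (x k)) (g k)).trans ?_).trans_lt hk
  gcongr

/-! ### Wave packets and their localization in phase space -/

/-- The increasing sequence of the seminorms `f ↦ max_{k, n ≤ q} sup_x |x|^k |∂^n f(x)|`, which
defines the topology of the Schwartz space. -/
noncomputable def schwartzNorm (q : ℕ) : Seminorm ℂ 𝓢(𝔼, ℂ) :=
  (Finset.Iic (q, q)).sup (schwartzSeminormFamily ℂ 𝔼 ℂ)

theorem seminorm_le_schwartzNorm {q p n : ℕ} (hp : p ≤ q) (hn : n ≤ q) (f : 𝓢(𝔼, ℂ)) :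
    SchwartzMap.seminorm ℂ p n f ≤ schwartzNorm q f :=
  Seminorm.le_finset_sup_apply (p := schwartzSeminormFamily ℂ 𝔼 ℂ) (i := (p, n))
    (Finset.mem_Iic.2 ⟨hp, hn⟩)

theorem sup_le_schwartzNorm {q p n : ℕ} (hp : p ≤ q) (hn : n ≤ q) (f : 𝓢(𝔼, ℂ)) :
    (Finset.Iic (p, n)).sup (schwartzSeminormFamily ℂ 𝔼 ℂ) f ≤ schwartzNorm q f :=
  Finset.sup_mono (f := schwartzSeminormFamily ℂ 𝔼 ℂ)
    (Finset.Iic_subset_Iic.2 (Prod.mk_le_mk.2 ⟨hp, hn⟩)) f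

theorem schwartzNorm_le {q : ℕ} {f : 𝓢(𝔼, ℂ)} {B : ℝ} (hB : 0 ≤ B)
    (h : ∀ p ≤ q, ∀ n ≤ q, SchwartzMap.seminorm ℂ p n f ≤ B) : schwartzNorm q f ≤ B :=
  Seminorm.finset_sup_apply_le hB fun i hi => h i.1 (Finset.mem_Iic.1 hi).1 i.2
    (Finset.mem_Iic.1 hi).2

theorem continuous_schwartzNorm (q : ℕ) : Continuous (schwartzNorm q : Seminorm ℂ 𝓢(𝔼, ℂ)) := by
  refine Seminorm.continuous (r := 1) ?_
  exact (schwartz_withSeminorms ℂ 𝔼 ℂ).hasBasis.mem_of_mem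
    ((schwartzSeminormFamily ℂ 𝔼 ℂ).basisSets_mem (Finset.Iic (q, q)) one_pos)

theorem exists_schwartzNorm_clm_le (A : 𝓢(𝔼, ℂ) →L[ℂ] 𝓢(𝔼, ℂ)) (q : ℕ) :
    ∃ q' : ℕ, ∃ C : ℝ, 0 ≤ C ∧ ∀ f, schwartzNorm q (A f) ≤ C * schwartzNorm q' f := by
  obtain ⟨s, C, -, h⟩ := Seminorm.bound_of_continuous (schwartz_withSeminorms ℂ 𝔼 ℂ)
    ((schwartzNorm q).comp A.toLinearMap) ((continuous_schwartzNorm q).comp A.continuous)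
  refine ⟨s.sup Prod.fst ⊔ s.sup Prod.snd, C, C.2, fun f => (h f).trans ?_⟩
  refine mul_le_mul_of_nonneg_left ?_ C.2
  refine Finset.sup_mono (f := schwartzSeminormFamily ℂ 𝔼 ℂ) (fun i hi => ?_) f
  exact Finset.mem_Iic.2 ⟨(Finset.le_sup (f := Prod.fst) hi).trans le_sup_left,
    (Finset.le_sup (f := Prod.snd) hi).trans le_sup_right⟩

/-- The wave packet `x ↦ exp(i ⟨x, ξ₀⟩) g(c (x - x₀))`, which is concentrated near the point
`(x₀, ξ₀)` of phase space, at scale `1 / c` in `x` and at scale `c` in `ξ`. -/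
noncomputable def packet (x₀ ξ₀ : 𝔼) (c : ℝˣ) (g : 𝓢(𝔼, ℂ)) : 𝓢(𝔼, ℂ) :=
  phaseShift x₀ ξ₀ (dilation c g)

theorem packet_apply (x₀ ξ₀ : 𝔼) (c : ℝˣ) (g : 𝓢(𝔼, ℂ)) (x : 𝔼) :
    packet x₀ ξ₀ c g x = planeWave (-ξ₀) x * g ((c : ℝ) • (x - x₀)) := by
  rw [packet, phaseShift_apply, dilation_apply]

theorem fourierSchwartz_packet (x₀ ξ₀ : 𝔼) (c : ℝˣ) (g : 𝓢(𝔼, ℂ)) :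
    fourierSchwartz d (packet x₀ ξ₀ c g) =
      (planeWave (-x₀) ξ₀ * ((|(c : ℝ) ^ d|⁻¹ : ℝ) : ℂ)) •
        packet ξ₀ (-x₀) c⁻¹ (fourierSchwartz d g) := by
  rw [packet, fourierSchwartz_phaseShift, fourierSchwartz_dilation, map_smul, smul_smul, packet]

theorem smulLeftCLM_packet {m : 𝔼 → ℂ} (hm : m.HasTemperateGrowth) (x₀ ξ₀ : 𝔼) (c : ℝˣ)
    (g : 𝓢(𝔼, ℂ)) : SchwartzMap.smulLeftCLM ℂ m (packet x₀ ξ₀ c g) =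
      packet x₀ ξ₀ c (SchwartzMap.smulLeftCLM ℂ (fun z => m (x₀ + (c : ℝ)⁻¹ • z)) g) := by
  ext x
  rw [SchwartzMap.smulLeftCLM_apply_apply hm, packet_apply, packet_apply,
    SchwartzMap.smulLeftCLM_apply_apply (hasTemperateGrowth_comp_affine hm _ _),
    inv_smul_smul₀ c.ne_zero, add_sub_cancel]
  simp only [smul_eq_mul]
  ring

theorem norm_iteratedFDeriv_planeWave_le (ξ x : 𝔼) (n : ℕ) :
    ‖iteratedFDeriv ℝ n (planeWave ξ) x‖ ≤ ‖ξ‖ ^ n := by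
  let e : ℝ → ℂ := fun t => Complex.exp (-Complex.I * (t : ℂ))
  have hd : ∀ n : ℕ, iteratedDeriv n e =
      fun t : ℝ => (-Complex.I) ^ n * Complex.exp (-Complex.I * (t : ℂ)) := by
    intro n
    induction n with
    | zero => simp [e]
    | succ n ih =>
      rw [iteratedDeriv_succ, ih]
      funext t
      have h1 : HasDerivAt (fun t : ℝ => -Complex.I * (t : ℂ)) (-Complex.I) t := by
        simpa using (Complex.ofRealCLM.hasDerivAt (x := t)).const_mul (-Complex.I)
      rw [(h1.cexp.const_mul ((-Complex.I) ^ n)).deriv]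
      ring
  have hn : ∀ t, ‖iteratedFDeriv ℝ n e t‖ = 1 := fun t => by
    rw [norm_iteratedFDeriv_eq_norm_iteratedDeriv, hd, norm_mul, norm_pow, norm_neg,
      Complex.norm_I, one_pow, one_mul, Complex.norm_exp]
    simp
  have he : ContDiff ℝ n e := (contDiff_const.mul Complex.ofRealCLM.contDiff).cexp
  have hc : planeWave ξ = e ∘ (innerSL ℝ ξ) := by
    ext y
    simp [planeWave, e, real_inner_comm]
  rw [hc, ContinuousLinearMap.iteratedFDeriv_comp_right (innerSL ℝ ξ) he x le_rfl]
  refine (ContinuousMultilinearMap.norm_compContinuousLinearMap_le _ _).trans ?_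
  rw [hn, one_mul, Finset.prod_const, Finset.card_univ, Fintype.card_fin, innerSL_apply_norm]

/-- A packet of frequency at most `s²` and concentration at most `s` has `l`-th derivatives of size
at most `(2 s²)^l`, times the size of its profile. -/
theorem norm_iteratedFDeriv_packet_le (x₀ ξ₀ : 𝔼) (c : ℝˣ) (g : 𝓢(𝔼, ℂ)) {s G : ℝ} (hs : 1 ≤ s)
    (hc0 : 0 < (c : ℝ)) (hc : (c : ℝ) ≤ s) (hξ : ‖ξ₀‖ ≤ s ^ 2) (x : 𝔼) (l : ℕ)
    (hG : ∀ b ≤ l, ‖iteratedFDeriv ℝ b g ((c : ℝ) • (x - x₀))‖ ≤ G) :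
    ‖iteratedFDeriv ℝ l (packet x₀ ξ₀ c g) x‖ ≤ (2 * s ^ 2) ^ l * G := by
  have hcoe : ⇑(packet x₀ ξ₀ c g) =
      fun y => planeWave (-ξ₀) y * g (-((c : ℝ) • x₀) + (c : ℝ) • y) := by
    ext y
    rw [packet_apply, smul_sub, sub_eq_neg_add]
  have hg : ContDiff ℝ ∞ (fun y : 𝔼 => g (-((c : ℝ) • x₀) + (c : ℝ) • y)) :=
    (hasTemperateGrowth_comp_affine g.hasTemperateGrowth _ _).1
  have hG0 : 0 ≤ G := (norm_nonneg _).trans (hG 0 (Nat.zero_le _))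
  rw [hcoe]
  refine (norm_iteratedFDeriv_mul_le (N := ∞) (planeWave_hasTemperateGrowth _).1 hg x
    (n := l) (mod_cast le_top)).trans ?_
  calc _ ≤ ∑ i ∈ Finset.range (l + 1), (l.choose i : ℝ) * ((s ^ 2) ^ l * G) := by
        refine Finset.sum_le_sum fun i hi => ?_
        have hil : i ≤ l := by simpa [Nat.lt_succ_iff] using hi
        rw [iteratedFDeriv_comp_affine (g.smooth ⊤), norm_smul, norm_pow,
          Real.norm_of_nonneg hc0.le, ← sub_eq_neg_add, ← smul_sub, mul_assoc]
        refine mul_le_mul_of_nonneg_left ?_ (by positivity)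
        have h1 := norm_iteratedFDeriv_planeWave_le (-ξ₀) x i
        rw [norm_neg] at h1
        have h2 : (c : ℝ) ≤ s ^ 2 := by nlinarith
        have h3 := hG (l - i) (Nat.sub_le _ _)
        calc _ ≤ (s ^ 2) ^ i * ((s ^ 2) ^ (l - i) * G) := by
              refine mul_le_mul (h1.trans (by gcongr)) ?_ (by positivity) (by positivity)
              gcongr
          _ = _ := by rw [← mul_assoc, ← pow_add, Nat.add_sub_cancel' hil]
    _ = _ := by
      rw [← Finset.sum_mul, mul_pow]
      have : ∑ i ∈ Finset.range (l + 1), (l.choose i : ℝ) = 2 ^ l := by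
        exact_mod_cast Nat.sum_range_choose l
      rw [this]; ring

/-- A cut-off `κ` is far away, at the scale of a packet at `x₀` of concentration `c`, if the
rescaled distance `c |x - x₀|` is polynomially large in `s (1 + |x|)` on the support of `κ`. -/
def IsFar (κ : 𝔼 → ℂ) (C s : ℝ) (x₀ : 𝔼) (c : ℝ) : Prop :=
  ∀ x ∈ Function.support κ, s * (1 + ‖x‖) ≤ C * (c * ‖x - x₀‖) ^ 3

/-- Cutting off a packet far away from its center leaves a rapidly decreasing remainder. -/
theorem exists_schwartzNorm_smulLeftCLM_packet_le {κ : 𝔼 → ℂ} (hκ : IsSymbol κ) {C₀ : ℝ}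
    (hC₀ : 0 ≤ C₀) (q N : ℕ) : ∃ q' : ℕ, ∃ C : ℝ, 0 ≤ C ∧ ∀ (s : ℝ) (x₀ ξ₀ : 𝔼) (c : ℝˣ)
      (g : 𝓢(𝔼, ℂ)), 1 ≤ s → 0 < (c : ℝ) → (c : ℝ) ≤ s → ‖ξ₀‖ ≤ s ^ 2 → IsFar κ C₀ s x₀ c →
      s ^ N * schwartzNorm q (SchwartzMap.smulLeftCLM ℂ κ (packet x₀ ξ₀ c g)) ≤
        C * schwartzNorm q' g := by
  obtain ⟨K, hK0, hK⟩ := hκ.exists_bound_iteratedFDeriv q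
  set M := q + N + 2 * q with hM
  set q' := 3 * M with hq'
  refine ⟨q', 4 ^ q * K * (C₀ ^ M * 2 ^ q'), by positivity,
    fun s x₀ ξ₀ c g hs hc0 hc hξ hfar => ?_⟩
  have hs0 : 0 < s := one_pos.trans_le hs
  set S := schwartzNorm q' g with hS
  have hS0 : 0 ≤ S := apply_nonneg _ _
  have hfar' : ∀ x ∈ tsupport κ, s * (1 + ‖x‖) ≤ C₀ * ((c : ℝ) * ‖x - x₀‖) ^ 3 := by
    have hcl : IsClosed {x : 𝔼 | s * (1 + ‖x‖) ≤ C₀ * ((c : ℝ) * ‖x - x₀‖) ^ 3} :=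
      isClosed_le (by fun_prop) (by fun_prop)
    exact fun x hx => closure_minimal hfar hcl hx
  rw [← le_div_iff₀' (by positivity)]
  refine schwartzNorm_le (by positivity) fun p hp n hn => ?_
  refine SchwartzMap.seminorm_le_bound ℂ p n _ (by positivity) fun x => ?_
  rw [le_div_iff₀' (by positivity)]
  have hcoe : ⇑(SchwartzMap.smulLeftCLM ℂ κ (packet x₀ ξ₀ c g)) =
      fun y => κ y * packet x₀ ξ₀ c g y := by
    ext y; simp [SchwartzMap.smulLeftCLM_apply_apply hκ.hasTemperateGrowth]
  by_cases hx : x ∈ tsupport κ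
  swap
  · have hx' : x ∉ tsupport (fun y => κ y * packet x₀ ξ₀ c g y) := fun h =>
      hx (tsupport_mul_subset_left h)
    have h0 : iteratedFDeriv ℝ n (fun y => κ y * packet x₀ ξ₀ c g y) x = 0 := by
      by_contra h
      exact hx' (support_iteratedFDeriv_subset n h)
    rw [hcoe, h0, norm_zero, mul_zero, mul_zero]
    positivity
  -- `Y ≤ C₀ |z|³`, where `z` is the rescaled variable, turns the decay of `g` into decay in `s`.
  set z := (c : ℝ) • (x - x₀) with hz
  set Y := s * (1 + ‖x‖) with hY
  have hY0 : 0 < Y := by positivity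
  have hYz : Y ^ M ≤ C₀ ^ M * (1 + ‖z‖) ^ q' := by
    have h1 : Y ≤ C₀ * (1 + ‖z‖) ^ 3 := by
      refine (hfar' x hx).trans ?_
      rw [hz, norm_smul, Real.norm_of_nonneg hc0.le]
      gcongr
      linarith
    calc Y ^ M ≤ (C₀ * (1 + ‖z‖) ^ 3) ^ M := by gcongr
      _ = _ := by rw [mul_pow, ← pow_mul]
  set G := C₀ ^ M * 2 ^ q' * S / Y ^ M with hG
  have hG0 : 0 ≤ G := by positivity
  have hgz : ∀ b ≤ q, ‖iteratedFDeriv ℝ b g z‖ ≤ G := by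
    intro b hb
    have h1 := SchwartzMap.one_add_le_sup_seminorm_apply (𝕜 := ℂ) (m := (q', q')) (k := q')
      (n := b) le_rfl (hb.trans (by simp only [hq', hM]; omega)) g z
    rw [hG, le_div_iff₀ (by positivity)]
    calc _ ≤ ‖iteratedFDeriv ℝ b g z‖ * (C₀ ^ M * (1 + ‖z‖) ^ q') := by gcongr
      _ = C₀ ^ M * ((1 + ‖z‖) ^ q' * ‖iteratedFDeriv ℝ b g z‖) := by ring
      _ ≤ C₀ ^ M * (2 ^ q' * S) := mul_le_mul_of_nonneg_left h1 (by positivity)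
      _ = _ := by ring
  have hle := norm_iteratedFDeriv_mul_le (N := ∞) hκ.contDiff ((packet x₀ ξ₀ c g).smooth ⊤) x
    (n := n) (mod_cast le_top)
  have hle2 : ‖iteratedFDeriv ℝ n (fun y => κ y * packet x₀ ξ₀ c g y) x‖ ≤
      4 ^ q * K * (s ^ (2 * q) * G) := by
    refine hle.trans ?_
    calc _ ≤ ∑ i ∈ Finset.range (n + 1), (n.choose i : ℝ) * (K * ((2 * s ^ 2) ^ q * G)) := by
          refine Finset.sum_le_sum fun i hi => ?_
          have hin : i ≤ n := by simpa [Nat.lt_succ_iff] using hi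
          rw [mul_assoc]
          refine mul_le_mul_of_nonneg_left ?_ (by positivity)
          refine mul_le_mul (hK i (hin.trans hn) x) ?_ (norm_nonneg _) hK0
          refine (norm_iteratedFDeriv_packet_le x₀ ξ₀ c g hs hc0 hc hξ x (n - i)
            fun b hb => hgz b (by omega)).trans ?_
          gcongr
          · nlinarith
          · omega
      _ = 2 ^ n * (K * ((2 * s ^ 2) ^ q * G)) := by
        rw [← Finset.sum_mul]
        have : ∑ i ∈ Finset.range (n + 1), (n.choose i : ℝ) = 2 ^ n := by
          exact_mod_cast Nat.sum_range_choose n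
        rw [this]
      _ ≤ 2 ^ q * (K * ((2 * s ^ 2) ^ q * G)) := by
        gcongr
        norm_num
      _ = _ := by
        rw [mul_pow, show (4 : ℝ) = 2 * 2 by norm_num, mul_pow, pow_mul]
        ring
  rw [hcoe]
  calc s ^ N * (‖x‖ ^ p * _) ≤ s ^ N * ((1 + ‖x‖) ^ q * (4 ^ q * K * (s ^ (2 * q) * G))) := by
        gcongr
        calc ‖x‖ ^ p ≤ (1 + ‖x‖) ^ p := by gcongr; linarith
          _ ≤ (1 + ‖x‖) ^ q := pow_le_pow_right₀ (by linarith [norm_nonneg x]) hp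
    _ = 4 ^ q * K * ((s ^ (N + 2 * q) * (1 + ‖x‖) ^ q) * G) := by rw [pow_add]; ring
    _ ≤ 4 ^ q * K * (Y ^ M * G) := by
      rw [hY, mul_pow]
      have h1 : s ^ (N + 2 * q) ≤ s ^ M := pow_le_pow_right₀ hs (by omega)
      have h2 : (1 + ‖x‖) ^ q ≤ (1 + ‖x‖) ^ M :=
        pow_le_pow_right₀ (by linarith [norm_nonneg x]) (by omega)
      gcongr
    _ = _ := by
      rw [hG, mul_div_cancel₀ _ (by positivity)]
      ring

/-- The localization `κ · F(m · packet)` of a packet to a region of phase space from which its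
center is far away, in position or in frequency, is rapidly decreasing in the parameter `s`. -/
theorem exists_schwartzNorm_localize_packet_le {m κ : 𝔼 → ℂ} (hm : IsSymbol m) (hκ : IsSymbol κ)
    {C₀ : ℝ} (hC₀ : 0 ≤ C₀) (g : 𝓢(𝔼, ℂ)) (q N : ℕ) : ∃ C : ℝ, ∀ (s : ℝ) (x₀ ξ₀ : 𝔼) (c : ℝˣ),
      1 ≤ s → 0 < (c : ℝ) → (c : ℝ) ≤ s → (c : ℝ)⁻¹ ≤ s → ‖x₀‖ ≤ s ^ 2 → ‖ξ₀‖ ≤ s ^ 2 →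
      ((c : ℝ)⁻¹) ^ 2 ≤ 1 + ‖x₀‖ → (IsFar m C₀ s x₀ c ∨ IsFar κ C₀ s ξ₀ (c : ℝ)⁻¹) →
      s ^ N * schwartzNorm q (SchwartzMap.smulLeftCLM ℂ κ
        (fourierSchwartz d (SchwartzMap.smulLeftCLM ℂ m (packet x₀ ξ₀ c g)))) ≤ C := by
  obtain ⟨q₁, C₁, hC₁, h₁⟩ :=
    exists_schwartzNorm_clm_le (SchwartzMap.smulLeftCLM ℂ κ ∘L fourierSchwartz d) q
  obtain ⟨q₂, C₂, hC₂, h₂⟩ := exists_schwartzNorm_smulLeftCLM_packet_le hm hC₀ q₁ N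
  obtain ⟨q₃, C₃, hC₃, h₃⟩ := exists_schwartzNorm_smulLeftCLM_packet_le hκ hC₀ q (N + d)
  obtain ⟨q₄, C₄, hC₄, h₄⟩ := exists_schwartzNorm_clm_le (fourierSchwartz d) q₃
  obtain ⟨C₅, hC₅, h₅⟩ := hm.norm_iteratedFDeriv_comp_affine_le q₄
  refine ⟨max (C₁ * (C₂ * schwartzNorm q₂ g)) (C₃ * (C₄ * (C₅ * (2 ^ q₄ * 2 ^ (q₄ + q₄) *
    schwartzNorm (q₄ + q₄) g)))), fun s x₀ ξ₀ c hs hc0 hc hc' hx hξ hcx hfar => ?_⟩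
  have hs0 : 0 < s := one_pos.trans_le hs
  rcases hfar with hfar | hfar
  · refine le_trans ?_ (le_max_left _ _)
    have e1 := h₁ (SchwartzMap.smulLeftCLM ℂ m (packet x₀ ξ₀ c g))
    have e2 := h₂ s x₀ ξ₀ c g hs hc0 hc hξ hfar
    calc _ ≤ s ^ N * (C₁ * _) := mul_le_mul_of_nonneg_left e1 (by positivity)
      _ = C₁ * (s ^ N * _) := by ring
      _ ≤ _ := mul_le_mul_of_nonneg_left e2 hC₁
  · refine le_trans ?_ (le_max_right _ _)
    set h := SchwartzMap.smulLeftCLM ℂ (fun z => m (x₀ + (c : ℝ)⁻¹ • z)) g with hh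
    have e0 : schwartzNorm q₄ h ≤ C₅ * (2 ^ q₄ * 2 ^ (q₄ + q₄) * schwartzNorm (q₄ + q₄) g) := by
      refine schwartzNorm_le (by positivity) fun p hp n hn => ?_
      refine (seminorm_smulLeftCLM_le (hasTemperateGrowth_comp_affine hm.hasTemperateGrowth _ _)
        p n q₄ (fun i hi => h₅ x₀ _ (by positivity) hcx i (hi.trans hn)) g).trans ?_
      have := sup_le_schwartzNorm (q := q₄ + q₄) (p := p + q₄) (n := n) (by omega) (by omega) g
      gcongr
      · norm_num
      · norm_num
    have e1 := h₄ h
    have hci : ((c⁻¹ : ℝˣ) : ℝ) = (c : ℝ)⁻¹ := by simp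
    have e2 := h₃ s ξ₀ (-x₀) c⁻¹ (fourierSchwartz d h) hs (by rw [hci]; positivity)
      (by rw [hci]; exact hc') (by rwa [norm_neg]) (by rwa [hci])
    rw [smulLeftCLM_packet hm.hasTemperateGrowth, fourierSchwartz_packet, map_smul, ← hh,
      map_smul_eq_mul, norm_mul, norm_planeWave, one_mul, Complex.norm_real, norm_inv,
      norm_abs_eq_norm, norm_pow, Real.norm_of_nonneg hc0.le, ← inv_pow, ← mul_assoc]
    calc _ ≤ s ^ N * s ^ d * _ := by
          refine mul_le_mul_of_nonneg_right ?_ (apply_nonneg _ _)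
          gcongr
      _ = s ^ (N + d) * _ := by rw [pow_add]
      _ ≤ _ := e2
      _ ≤ _ := by
        refine mul_le_mul_of_nonneg_left (e1.trans ?_) hC₃
        gcongr

/-! ### Series of Schwartz functions -/

/-- A series of Schwartz functions all whose Schwartz seminorms are summable converges to a Schwartz
function. -/
theorem exists_schwartz_hasSum {W : ℕ → 𝓢(𝔼, ℂ)}
    (hW : ∀ p n, Summable fun j => SchwartzMap.seminorm ℂ p n (W j)) :
    ∃ w : 𝓢(𝔼, ℂ), (∀ x, HasSum (fun j => W j x) (w x)) ∧
      ∀ f : 𝓢(𝔼, ℂ), HasSum (fun j => ∫ x, W j x * f x) (∫ x, w x * f x) := by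
  have hv : ∀ (k i : ℕ) (x : 𝔼), ‖iteratedFDeriv ℝ k (W i) x‖ ≤ SchwartzMap.seminorm ℂ 0 k (W i) :=
    fun k i x => SchwartzMap.norm_iteratedFDeriv_le_seminorm ℂ (W i) k x
  have hsm : ∀ i, ContDiff ℝ ((⊤ : ℕ∞) : WithTop ℕ∞) (W i) := fun i => (W i).smooth ⊤
  let w : 𝓢(𝔼, ℂ) :=
    { toFun := fun x => ∑' j, W j x
      smooth' := contDiff_tsum hsm (fun k _ => hW 0 k) fun k i x _ => hv k i x
      decay' := fun p n => by
        refine ⟨∑' j, SchwartzMap.seminorm ℂ p n (W j), fun x => ?_⟩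
        rw [iteratedFDeriv_tsum_apply hsm (fun k _ => hW 0 k) (fun k i x _ => hv k i x)
          (k := n) (mod_cast le_top) x]
        have hs1 : Summable fun j => ‖iteratedFDeriv ℝ n (W j) x‖ :=
          Summable.of_nonneg_of_le (fun _ => norm_nonneg _) (fun i => hv n i x) (hW 0 n)
        calc _ ≤ ‖x‖ ^ p * ∑' j, ‖iteratedFDeriv ℝ n (W j) x‖ := by
              gcongr
              exact norm_tsum_le_tsum_norm hs1
          _ = ∑' j, ‖x‖ ^ p * ‖iteratedFDeriv ℝ n (W j) x‖ := (tsum_mul_left).symm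
          _ ≤ _ := (hs1.mul_left _).tsum_le_tsum
            (fun j => SchwartzMap.le_seminorm ℂ p n (W j) x) (hW p n) }
  have hb : ∀ j x, ‖W j x‖ ≤ SchwartzMap.seminorm ℂ 0 0 (W j) := fun j x =>
    SchwartzMap.norm_le_seminorm ℂ (W j) x
  have hsum : ∀ x, HasSum (fun j => W j x) (w x) := fun x =>
    (Summable.of_norm_bounded (hW 0 0) fun j => hb j x).hasSum
  refine ⟨w, hsum, fun f => ?_⟩
  have hint : ∀ j, Integrable fun x => W j x * f x := fun j =>
    f.integrable.bdd_mul (W j).continuous.aestronglyMeasurable (.of_forall (hb j))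
  have hsi : Summable fun j => ∫ x, ‖W j x * f x‖ := by
    refine Summable.of_nonneg_of_le (fun _ => integral_nonneg fun _ => norm_nonneg _) (fun j => ?_)
      ((hW 0 0).mul_right (∫ x, ‖f x‖))
    rw [← integral_const_mul]
    refine integral_mono (hint j).norm (f.integrable.norm.const_mul _) fun x => ?_
    simp only [norm_mul]
    exact mul_le_mul_of_nonneg_right (hb j x) (norm_nonneg _)
  have := hasSum_integral_of_summable_integral_norm hint hsi
  convert! this using 1
  refine integral_congr_ae (.of_forall fun x => ?_)
  exact ((hsum x).mul_right (f x)).tsum_eq.symm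

/-! ### Lacunary sums of wave packets -/

/-- The parameters of a lacunary family of wave packets: the `k`-th packet sits at the point
`(x k, ξ k)` of phase space, and `s k ^ 2` is the size of the largest component of this point.
For `k ∈ highFreq` the frequency is that large, and the packet has width `1 / s k`; for `k ∈ farOut`
the position is that large, and the packet has width `s k`. The remaining indices are not used. The
function `ρ` is the common profile. -/
structure PacketFamily (d : ℕ) where
  /-- the square root of the size of the `k`-th center -/
  s : ℕ → ℝˣ
  /-- the position of the `k`-th packet -/
  x : ℕ → EuclideanSpace ℝ (Fin d)
  /-- the frequency of the `k`-th packet -/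
  ξ : ℕ → EuclideanSpace ℝ (Fin d)
  /-- the packets of high frequency -/
  highFreq : Set ℕ
  /-- the packets far away from the origin -/
  farOut : Set ℕ
  /-- the profile -/
  ρ : 𝓢(EuclideanSpace ℝ (Fin d), ℂ)
  disjoint : Disjoint highFreq farOut
  le_s : ∀ k, (2 : ℝ) ^ (k + 2) ≤ s k
  s_succ : ∀ k, 2 * (s k : ℝ) ≤ s (k + 1)
  norm_x_le : ∀ k, ‖x k‖ ≤ (s k : ℝ) ^ 2
  norm_ξ_le : ∀ k, ‖ξ k‖ ≤ (s k : ℝ) ^ 2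
  norm_ξ : ∀ k ∈ highFreq, ‖ξ k‖ = (s k : ℝ) ^ 2
  norm_x : ∀ k ∈ farOut, ‖x k‖ = (s k : ℝ) ^ 2
  ρ_zero : ρ 0 = 1
  norm_ρ_le : ∀ z, ‖ρ z‖ ≤ 1
  ρ_eq_zero : ∀ z, 1 < ‖z‖ → ρ z = 0

namespace PacketFamily

theorem four_le_s (D : PacketFamily d) (k : ℕ) : (4 : ℝ) ≤ D.s k := by
  have h1 : (2 : ℝ) ^ 2 ≤ 2 ^ (k + 2) := pow_le_pow_right₀ one_le_two (by omega)
  have h2 := D.le_s k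
  norm_num at h1
  linarith

theorem s_pos (D : PacketFamily d) (k : ℕ) : (0 : ℝ) < D.s k := by
  linarith [D.four_le_s k]

theorem two_mul_s_le (D : PacketFamily d) {j k : ℕ} (h : j < k) : 2 * (D.s j : ℝ) ≤ D.s k := by
  induction k, h using Nat.le_induction with
  | base => exact D.s_succ j
  | succ k _ ih => linarith [D.s_succ k, D.s_pos k]

theorem tendsto_s (D : PacketFamily d) :
    Filter.Tendsto (fun k => (D.s k : ℝ)) Filter.atTop Filter.atTop :=
  Filter.tendsto_atTop_mono D.le_s
    ((tendsto_pow_atTop_atTop_of_one_lt one_lt_two).comp (Filter.tendsto_add_atTop_nat 2))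

theorem tendsto_s_sq (D : PacketFamily d) :
    Filter.Tendsto (fun k => (D.s k : ℝ) ^ 2) Filter.atTop Filter.atTop :=
  (Filter.tendsto_pow_atTop two_ne_zero).comp D.tendsto_s

theorem summable_inv_s (D : PacketFamily d) : Summable fun k => ((D.s k : ℝ))⁻¹ := by
  refine Summable.of_nonneg_of_le (fun k => (inv_pos.2 (D.s_pos k)).le) (fun k => ?_)
    (summable_geometric_two)
  rw [one_div, inv_pow]
  refine inv_anti₀ (by positivity) ((pow_le_pow_right₀ one_le_two (by omega)).trans (D.le_s k))

/-- The sum of the packets of width `s k` at the points `(y k, η k)`, for `k ∈ S`. -/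
noncomputable def lacunarySum (D : PacketFamily d) (S : Set ℕ) (y η : ℕ → 𝔼) (x : 𝔼) : ℂ :=
  ∑' k, S.indicator (fun k => packet (y k) (η k) (D.s k)⁻¹ D.ρ x) k

/-- The `k`-th term of a lacunary sum lives in an annulus of radius `(s k)²`. -/
theorem norm_mem_of_packet_ne_zero (D : PacketFamily d) {y η x : 𝔼} {k : ℕ}
    (hy : ‖y‖ = (D.s k : ℝ) ^ 2) (h : packet y η (D.s k)⁻¹ D.ρ x ≠ 0) :
    3 / 4 * (D.s k : ℝ) ^ 2 ≤ ‖x‖ ∧ ‖x‖ ≤ 5 / 4 * (D.s k : ℝ) ^ 2 := by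
  have h4 := D.four_le_s k
  have hs := D.s_pos k
  have h1 : ‖x - y‖ ≤ D.s k := by
    by_contra hlt
    push Not at hlt
    refine h ?_
    rw [packet_apply, D.ρ_eq_zero, mul_zero]
    rw [norm_smul, Units.val_inv_eq_inv_val, norm_inv, Real.norm_of_nonneg hs.le,
      lt_inv_mul_iff₀ hs, mul_one]
    exact hlt
  have h2 : ‖x‖ ≤ ‖x - y‖ + ‖y‖ := by simpa using norm_add_le (x - y) y
  have h3 : ‖y‖ ≤ ‖x‖ + ‖x - y‖ := by simpa using norm_sub_le x (x - y)
  constructor <;> nlinarith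

theorem eq_of_annuli (D : PacketFamily d) {r : ℝ} {j k : ℕ}
    (hj : 3 / 4 * (D.s j : ℝ) ^ 2 ≤ r ∧ r ≤ 5 / 4 * (D.s j : ℝ) ^ 2)
    (hk : 3 / 4 * (D.s k : ℝ) ^ 2 ≤ r ∧ r ≤ 5 / 4 * (D.s k : ℝ) ^ 2) : j = k := by
  have hj0 := D.s_pos j
  have hk0 := D.s_pos k
  rcases lt_trichotomy j k with h | h | h
  · have := D.two_mul_s_le h
    nlinarith
  · exact h
  · have := D.two_mul_s_le h
    nlinarith

variable (D : PacketFamily d) {S : Set ℕ}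

theorem exists_forall_ne_eq_zero {y : ℕ → EuclideanSpace ℝ (Fin d)}
    (hy : ∀ k ∈ S, ‖y k‖ = (D.s k : ℝ) ^ 2) (η : ℕ → EuclideanSpace ℝ (Fin d))
    (x : EuclideanSpace ℝ (Fin d)) :
    ∃ k, ∀ j, j ≠ k → S.indicator (fun k => packet (y k) (η k) (D.s k)⁻¹ D.ρ x) j = 0 := by
  by_cases h : ∃ k, S.indicator (fun k => packet (y k) (η k) (D.s k)⁻¹ D.ρ x) k ≠ 0
  · obtain ⟨k, hk⟩ := h
    refine ⟨k, fun j hjk => ?_⟩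
    by_contra hj
    have hkS := Set.mem_of_indicator_ne_zero hk
    have hjS := Set.mem_of_indicator_ne_zero hj
    rw [Set.indicator_of_mem hkS] at hk
    rw [Set.indicator_of_mem hjS] at hj
    exact hjk (D.eq_of_annuli (D.norm_mem_of_packet_ne_zero (hy j hjS) hj)
      (D.norm_mem_of_packet_ne_zero (hy k hkS) hk))
  · push Not at h
    exact ⟨0, fun j _ => h j⟩

theorem norm_packet_le (y η x : EuclideanSpace ℝ (Fin d)) (k : ℕ) :
    ‖packet y η (D.s k)⁻¹ D.ρ x‖ ≤ 1 := by
  rw [packet_apply, norm_mul, norm_planeWave, one_mul]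
  exact D.norm_ρ_le _

theorem hasSum_lacunarySum {y : ℕ → EuclideanSpace ℝ (Fin d)}
    (hy : ∀ k ∈ S, ‖y k‖ = (D.s k : ℝ) ^ 2) (η : ℕ → EuclideanSpace ℝ (Fin d))
    (x : EuclideanSpace ℝ (Fin d)) :
    HasSum (fun k => S.indicator (fun k => packet (y k) (η k) (D.s k)⁻¹ D.ρ x) k)
      (D.lacunarySum S y η x) := by
  obtain ⟨k, hk⟩ := D.exists_forall_ne_eq_zero hy η x
  exact (summable_of_ne_finset_zero (s := {k}) (by simpa using hk)).hasSum

theorem norm_lacunarySum_le {y : ℕ → EuclideanSpace ℝ (Fin d)}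
    (hy : ∀ k ∈ S, ‖y k‖ = (D.s k : ℝ) ^ 2) (η : ℕ → EuclideanSpace ℝ (Fin d))
    (x : EuclideanSpace ℝ (Fin d)) : ‖D.lacunarySum S y η x‖ ≤ 1 := by
  obtain ⟨k, hk⟩ := D.exists_forall_ne_eq_zero hy η x
  rw [lacunarySum, tsum_eq_single k hk]
  exact (norm_indicator_le_norm_self _ _).trans (D.norm_packet_le _ _ _ _)

theorem measurable_lacunarySum {y : ℕ → EuclideanSpace ℝ (Fin d)}
    (hy : ∀ k ∈ S, ‖y k‖ = (D.s k : ℝ) ^ 2) (η : ℕ → EuclideanSpace ℝ (Fin d)) :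
    Measurable (D.lacunarySum S y η) := by
  refine measurable_of_tendsto_metrizable (f := fun n x => ∑ k ∈ Finset.range n,
    S.indicator (fun k => packet (y k) (η k) (D.s k)⁻¹ D.ρ x) k) (fun n => ?_) ?_
  · refine Finset.measurable_sum _ fun k _ => ?_
    by_cases hk : k ∈ S
    · simp only [Set.indicator_of_mem hk]
      exact (packet (y k) (η k) (D.s k)⁻¹ D.ρ).continuous.measurable
    · simp only [Set.indicator_of_notMem hk]
      exact measurable_const
  · rw [tendsto_pi_nhds]
    exact fun x => (D.hasSum_lacunarySum hy η x).tendsto_sum_nat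

theorem memLp_lacunarySum {y : ℕ → EuclideanSpace ℝ (Fin d)}
    (hy : ∀ k ∈ S, ‖y k‖ = (D.s k : ℝ) ^ 2) (η : ℕ → EuclideanSpace ℝ (Fin d)) :
    MemLp (D.lacunarySum S y η) ⊤ :=
  memLp_top_of_bound (D.measurable_lacunarySum hy η).aestronglyMeasurable 1
    (.of_forall (D.norm_lacunarySum_le hy η))

/-- Close to a point of norm `(s k)²`, only the `k`-th term of a lacunary sum is visible. -/
theorem lacunarySum_add {y : ℕ → EuclideanSpace ℝ (Fin d)}
    (hy : ∀ k ∈ S, ‖y k‖ = (D.s k : ℝ) ^ 2) (η : ℕ → EuclideanSpace ℝ (Fin d)) {k : ℕ}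
    {p z : EuclideanSpace ℝ (Fin d)} (hp : ‖p‖ = (D.s k : ℝ) ^ 2)
    (hz : ‖z‖ ≤ (D.s k : ℝ) ^ 2 / 4) : D.lacunarySum S y η (p + z) =
      S.indicator (fun k => packet (y k) (η k) (D.s k)⁻¹ D.ρ (p + z)) k := by
  refine tsum_eq_single k fun j hjk => ?_
  by_contra hj
  have hjS := Set.mem_of_indicator_ne_zero hj
  rw [Set.indicator_of_mem hjS] at hj
  refine hjk (D.eq_of_annuli (D.norm_mem_of_packet_ne_zero (hy j hjS) hj) ?_)
  have h1 := norm_add_le p z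
  have h2 : ‖p‖ ≤ ‖p + z‖ + ‖z‖ := by simpa using norm_sub_le (p + z) z
  constructor <;> linarith

theorem hasSum_integral_lacunarySum {y : ℕ → EuclideanSpace ℝ (Fin d)}
    (hy : ∀ k ∈ S, ‖y k‖ = (D.s k : ℝ) ^ 2) (η : ℕ → EuclideanSpace ℝ (Fin d))
    (f : 𝓢(EuclideanSpace ℝ (Fin d), ℂ)) :
    HasSum (fun k => S.indicator (fun k => ∫ x, packet (y k) (η k) (D.s k)⁻¹ D.ρ x * f x) k)
      (∫ x, D.lacunarySum S y η x * f x) := by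
  set W : ℕ → EuclideanSpace ℝ (Fin d) → ℂ := fun k x =>
    S.indicator (fun k => packet (y k) (η k) (D.s k)⁻¹ D.ρ x) k with hW
  have hc : ∀ k, Continuous (W k) := fun k => by
    by_cases hk : k ∈ S
    · simp only [hW, Set.indicator_of_mem hk]
      exact (packet (y k) (η k) (D.s k)⁻¹ D.ρ).continuous
    · simp only [hW, Set.indicator_of_notMem hk]
      exact continuous_const
  have hn : ∀ x, Summable (fun k => ‖W k x‖) ∧ ∑' k, ‖W k x‖ ≤ 1 := fun x => by
    obtain ⟨k, hk⟩ := D.exists_forall_ne_eq_zero hy η x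
    have hk' : ∀ j, j ≠ k → ‖W j x‖ = 0 := fun j hj => by rw [norm_eq_zero]; exact hk j hj
    refine ⟨summable_of_ne_finset_zero (s := {k}) (by simpa using hk'), ?_⟩
    rw [tsum_eq_single k hk']
    exact (norm_indicator_le_norm_self _ _).trans (D.norm_packet_le _ _ _ _)
  have h := hasSum_integral_of_dominated_convergence (μ := volume)
    (F := fun k x => W k x * f x) (f := fun x => D.lacunarySum S y η x * f x)
    (fun k x => ‖W k x‖ * ‖f x‖) (fun k => ((hc k).mul f.continuous).aestronglyMeasurable)
    (fun k => .of_forall fun x => by rw [norm_mul])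
    (.of_forall fun x => (hn x).1.mul_right _) ?_
    (.of_forall fun x => (D.hasSum_lacunarySum hy η x).mul_right _)
  · convert! h using 1
    ext k
    by_cases hk : k ∈ S
    · simp [hW, Set.indicator_of_mem hk]
    · simp [hW, Set.indicator_of_notMem hk]
  · refine f.integrable.norm.mono' ?_ (.of_forall fun x => ?_)
    · refine Measurable.aestronglyMeasurable ?_
      refine measurable_of_tendsto_metrizable (f := fun n x => ∑ k ∈ Finset.range n,
        ‖W k x‖ * ‖f x‖) (fun n => ?_) ?_
      · exact Finset.measurable_sum _ fun k _ =>
          ((hc k).norm.mul f.continuous.norm).measurable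
      · rw [tendsto_pi_nhds]
        exact fun x => ((hn x).1.mul_right _).hasSum.tendsto_sum_nat
    · rw [tsum_mul_right, Real.norm_of_nonneg
        (mul_nonneg (tsum_nonneg fun _ => norm_nonneg _) (norm_nonneg _))]
      exact mul_le_of_le_one_left (norm_nonneg _) (hn x).2

/-! ### The distribution carried by a lacunary family of packets -/

/-- The sum of the packets which are far out. -/
noncomputable def farPart : EuclideanSpace ℝ (Fin d) → ℂ := D.lacunarySum D.farOut D.x D.ξ

/-- The function whose Fourier transform is the sum of the packets of high frequency. -/
noncomputable def freqPart : EuclideanSpace ℝ (Fin d) → ℂ := D.lacunarySum D.highFreq (-D.ξ) D.x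

theorem norm_neg_ξ : ∀ k ∈ D.highFreq, ‖(-D.ξ) k‖ = (D.s k : ℝ) ^ 2 := fun k hk => by
  rw [Pi.neg_apply, norm_neg, D.norm_ξ k hk]

/-- The tempered distribution which is the sum of the packets of the family. -/
noncomputable def distr : 𝓢'(EuclideanSpace ℝ (Fin d), ℂ) :=
  Lp.toTemperedDistribution ((D.memLp_lacunarySum D.norm_x D.ξ).toLp D.farPart) +
    fourierDistr (Lp.toTemperedDistribution
      ((D.memLp_lacunarySum D.norm_neg_ξ D.x).toLp D.freqPart))

theorem distr_apply (f : 𝓢(EuclideanSpace ℝ (Fin d), ℂ)) :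
    D.distr f = (∫ x, D.farPart x * f x) + ∫ ξ, D.freqPart ξ * fourierSchwartz d f ξ := by
  have key : ∀ {h : EuclideanSpace ℝ (Fin d) → ℂ} (hh : MemLp h ⊤)
      (f : 𝓢(EuclideanSpace ℝ (Fin d), ℂ)),
      Lp.toTemperedDistribution (hh.toLp h) f = ∫ x, h x * f x := by
    intro h hh f
    rw [Lp.toTemperedDistribution_apply]
    refine integral_congr_ae ?_
    filter_upwards [hh.coeFn_toLp] with x hx
    rw [hx, smul_eq_mul, mul_comm]
  exact congrArg₂ (· + ·) (key (D.memLp_lacunarySum D.norm_x D.ξ) f)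
    (key (D.memLp_lacunarySum D.norm_neg_ξ D.x) (fourierSchwartz d f))

theorem norm_distr_apply_le (f : 𝓢(EuclideanSpace ℝ (Fin d), ℂ)) :
    ‖D.distr f‖ ≤ (∫ x, ‖f x‖) + ∫ ξ, ‖fourierSchwartz d f ξ‖ := by
  have key : ∀ {h : EuclideanSpace ℝ (Fin d) → ℂ} (hh : ∀ x, ‖h x‖ ≤ 1)
      (f : 𝓢(EuclideanSpace ℝ (Fin d), ℂ)), ‖∫ x, h x * f x‖ ≤ ∫ x, ‖f x‖ := by
    intro h hh f
    refine norm_integral_le_of_norm_le f.integrable.norm (.of_forall fun x => ?_)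
    rw [norm_mul]
    exact mul_le_of_le_one_left (norm_nonneg _) (hh x)
  rw [distr_apply]
  exact (norm_add_le _ _).trans (add_le_add (key (D.norm_lacunarySum_le D.norm_x D.ξ) f)
    (key (D.norm_lacunarySum_le D.norm_neg_ξ D.x) _))

open Classical in
/-- The `k`-th packet of the family. -/
noncomputable def term (k : ℕ) : 𝓢(EuclideanSpace ℝ (Fin d), ℂ) :=
  if k ∈ D.farOut then packet (D.x k) (D.ξ k) (D.s k)⁻¹ D.ρ
  else if k ∈ D.highFreq then fourierSchwartz d (packet (-D.ξ k) (D.x k) (D.s k)⁻¹ D.ρ)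
  else 0

theorem term_of_farOut {k : ℕ} (hk : k ∈ D.farOut) :
    D.term k = packet (D.x k) (D.ξ k) (D.s k)⁻¹ D.ρ := if_pos hk

theorem term_of_highFreq {k : ℕ} (hk : k ∈ D.highFreq) :
    D.term k = fourierSchwartz d (packet (-D.ξ k) (D.x k) (D.s k)⁻¹ D.ρ) := by
  rw [term, if_neg (Set.disjoint_left.1 D.disjoint hk), if_pos hk]

theorem term_of_notMem {k : ℕ} (hB : k ∉ D.farOut) (hA : k ∉ D.highFreq) : D.term k = 0 := by
  rw [term, if_neg hB, if_neg hA]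

theorem hasSum_distr (f : 𝓢(EuclideanSpace ℝ (Fin d), ℂ)) :
    HasSum (fun k => ∫ x, D.term k x * f x) (D.distr f) := by
  rw [distr_apply]
  convert! (D.hasSum_integral_lacunarySum D.norm_x D.ξ f).add
    (D.hasSum_integral_lacunarySum D.norm_neg_ξ D.x (fourierSchwartz d f)) using 1
  ext k
  by_cases hB : k ∈ D.farOut
  · have hA : k ∉ D.highFreq := Set.disjoint_right.1 D.disjoint hB
    rw [Set.indicator_of_mem hB, Set.indicator_of_notMem hA, add_zero, term_of_farOut D hB]
  · rw [Set.indicator_of_notMem hB, zero_add]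
    by_cases hA : k ∈ D.highFreq
    · rw [Set.indicator_of_mem hA, term_of_highFreq D hA, integral_fourierSchwartz_mul]
      rfl
    · rw [Set.indicator_of_notMem hA, term_of_notMem D hB hA]
      simp

end PacketFamily

/-! ### The geometry of the compactification -/

theorem one_add_norm_le_two_mul_sqrt (x : 𝔼) : 1 + ‖x‖ ≤ 2 * √(1 + ‖x‖ ^ 2) := by
  have h1 : 1 ≤ √(1 + ‖x‖ ^ 2) := Real.one_le_sqrt.2 (by nlinarith [sq_nonneg ‖x‖])
  have h2 : ‖x‖ ≤ √(1 + ‖x‖ ^ 2) := Real.le_sqrt_of_sq_le (by linarith)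
  linarith

theorem norm_toBall_lt_one (x : 𝔼) : ‖toBall x‖ < 1 := by
  have h : ‖x‖ < √(1 + ‖x‖ ^ 2) := Real.lt_sqrt_of_sq_lt (by linarith)
  have h0 : 0 < √(1 + ‖x‖ ^ 2) := (norm_nonneg x).trans_lt h
  rw [toBall, norm_smul, norm_inv, Real.norm_of_nonneg h0.le, inv_mul_lt_iff₀ h0, mul_one]
  exact h

/-- Up to a constant, `toBall` is Lipschitz with the weight `1 / (1 + |x|)`. -/
theorem norm_toBall_sub_mul_le (x y : 𝔼) : ‖toBall x - toBall y‖ * (1 + ‖x‖) ≤ 4 * ‖x - y‖ := by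
  set a := √(1 + ‖x‖ ^ 2) with ha
  set b := √(1 + ‖y‖ ^ 2) with hb
  have ha0 : 0 < a := Real.sqrt_pos.2 (by positivity)
  have hb0 : 0 < b := Real.sqrt_pos.2 (by positivity)
  have ha2 : a ^ 2 = 1 + ‖x‖ ^ 2 := Real.sq_sqrt (by positivity)
  have hb2 : b ^ 2 = 1 + ‖y‖ ^ 2 := Real.sq_sqrt (by positivity)
  have hxa : ‖x‖ ≤ a := Real.le_sqrt_of_sq_le (by linarith)
  have hyb : ‖y‖ ≤ b := Real.le_sqrt_of_sq_le (by linarith)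
  have hab : |b - a| ≤ ‖x - y‖ := by
    have h1 : |b - a| * (b + a) = |‖y‖ - ‖x‖| * (‖y‖ + ‖x‖) := by
      rw [← abs_of_pos (add_pos hb0 ha0), ← abs_mul,
        ← abs_of_nonneg (add_nonneg (norm_nonneg y) (norm_nonneg x)), ← abs_mul]
      congr 1
      linear_combination hb2 - ha2
    have h2 : |‖y‖ - ‖x‖| ≤ ‖x - y‖ := by
      rw [norm_sub_rev]; exact abs_norm_sub_norm_le y x
    have h3 : |b - a| * (b + a) ≤ ‖x - y‖ * (b + a) := by
      rw [h1]
      exact mul_le_mul h2 (by linarith) (by positivity) (norm_nonneg _)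
    exact le_of_mul_le_mul_right h3 (by positivity)
  have e : a • (toBall x - toBall y) = (x - y) + ((b - a) * b⁻¹) • y := by
    rw [toBall, toBall, ← ha, ← hb, smul_sub, smul_inv_smul₀ ha0.ne', smul_smul, sub_mul,
      mul_inv_cancel₀ hb0.ne', sub_smul, one_smul]
    abel
  have h1 : a * ‖toBall x - toBall y‖ ≤ 2 * ‖x - y‖ := by
    calc a * ‖toBall x - toBall y‖ = ‖a • (toBall x - toBall y)‖ := by
          rw [norm_smul, Real.norm_of_nonneg ha0.le]
      _ ≤ ‖x - y‖ + |b - a| * (b⁻¹ * ‖y‖) := by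
          rw [e]
          refine (norm_add_le _ _).trans ?_
          rw [norm_smul, norm_mul, norm_inv, Real.norm_of_nonneg hb0.le, Real.norm_eq_abs,
            mul_assoc]
      _ ≤ ‖x - y‖ + ‖x - y‖ * 1 := by
          gcongr
          rw [inv_mul_le_iff₀ hb0]
          linarith
      _ = _ := by ring
  have := one_add_norm_le_two_mul_sqrt x
  nlinarith [norm_nonneg (toBall x - toBall y)]

theorem continuous_toBall : Continuous (toBall : 𝔼 → 𝔼) := by
  unfold toBall
  refine Continuous.smul (Continuous.inv₀
    (continuous_const.add (continuous_norm.pow 2)).sqrt fun x => ?_) continuous_id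
  have : 0 < √(1 + ‖x‖ ^ 2) := Real.sqrt_pos.2 (by positivity)
  exact this.ne'

/-- The inverse of `toBall` on the open unit ball; the values elsewhere play no role. -/
noncomputable def ofBall (p : 𝔼) : 𝔼 := (√(1 - ‖p‖ ^ 2))⁻¹ • p

theorem toBall_ofBall {p : 𝔼} (hp : ‖p‖ < 1) : toBall (ofBall p) = p := by
  have h1 : 0 < 1 - ‖p‖ ^ 2 := by nlinarith [norm_nonneg p]
  have h2 : 1 + ‖ofBall p‖ ^ 2 = (1 - ‖p‖ ^ 2)⁻¹ := by
    rw [ofBall, norm_smul, norm_inv, Real.norm_of_nonneg (Real.sqrt_nonneg _), mul_pow, inv_pow,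
      Real.sq_sqrt h1.le]
    field_simp
    ring
  rw [toBall, h2, ofBall, smul_smul, Real.sqrt_inv, inv_inv,
    mul_inv_cancel₀ (Real.sqrt_pos.2 h1).ne', one_smul]

theorem norm_toBall_smul_sub_le {t : ℝ} (ht : 0 < t) {θ : 𝔼} (hθ : ‖θ‖ = 1) :
    ‖toBall (t • θ) - θ‖ ≤ t⁻¹ := by
  rw [toBall, norm_smul, hθ, mul_one, Real.norm_of_nonneg ht.le, smul_smul]
  set a := √(1 + t ^ 2)
  have hta : t ≤ a := Real.le_sqrt_of_sq_le (by linarith)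
  have hat : a ≤ t + 1 := Real.sqrt_le_iff.2 ⟨by linarith, by nlinarith⟩
  have ha0 : 0 < a := ht.trans_le hta
  have e : (a⁻¹ * t) • θ - θ = (a⁻¹ * t - 1) • θ := by rw [sub_smul, one_smul]
  rw [e, norm_smul, hθ, mul_one, Real.norm_eq_abs, abs_le]
  have h1 : a⁻¹ * t ≤ 1 := by rw [inv_mul_le_iff₀ ha0]; linarith
  have h2 : a⁻¹ ≤ t⁻¹ := inv_anti₀ ht hta
  have h3 : 1 ≤ a⁻¹ * t + a⁻¹ := by
    have : 1 = a⁻¹ * a := (inv_mul_cancel₀ ha0.ne').symm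
    nlinarith [inv_pos.2 ha0]
  constructor
  · linarith
  · linarith [inv_pos.2 ht]

theorem le_norm_sub_of_le_norm_toBall_sub {x y : 𝔼} {δ : ℝ} (h : δ ≤ ‖toBall x - toBall y‖) :
    δ / 4 * (1 + ‖x‖) ≤ ‖x - y‖ ∧ δ / 4 * (1 + ‖y‖) ≤ ‖x - y‖ := by
  have h1 := norm_toBall_sub_mul_le x y
  have h2 := norm_toBall_sub_mul_le y x
  rw [norm_sub_rev (toBall y), norm_sub_rev y] at h2
  constructor
  · nlinarith [norm_nonneg x]
  · nlinarith [norm_nonneg y]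

/-- Far in the compactification implies far at the scale of a packet of width `1 / s`, wherever its
center is. -/
theorem isFar_narrow {κ : 𝔼 → ℂ} {δ s : ℝ} {x₀ : 𝔼} (hδ : 0 < δ) (hs : 1 ≤ s)
    (h : ∀ x ∈ Function.support κ, δ ≤ ‖toBall x - toBall x₀‖) :
    IsFar κ ((4 / δ) ^ 3) s x₀ s := by
  intro x hx
  have h1 := (le_norm_sub_of_le_norm_toBall_sub (h x hx)).1
  have hs0 : 0 < s := one_pos.trans_le hs
  have h2 : 1 ≤ s * (1 + ‖x‖) := by nlinarith [norm_nonneg x]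
  calc s * (1 + ‖x‖) ≤ (s * (1 + ‖x‖)) ^ 3 := le_self_pow₀ h2 (by norm_num)
    _ = (4 / δ) ^ 3 * (s * (δ / 4 * (1 + ‖x‖))) ^ 3 := by field_simp
    _ ≤ _ := by gcongr

/-- Far in the compactification implies far at the scale of a packet of width `s`, if its center is
at distance `s²` from the origin. -/
theorem isFar_wide {κ : 𝔼 → ℂ} {δ s : ℝ} {x₀ : 𝔼} (hδ : 0 < δ) (hs : 1 ≤ s)
    (hx₀ : ‖x₀‖ = s ^ 2) (h : ∀ x ∈ Function.support κ, δ ≤ ‖toBall x - toBall x₀‖) :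
    IsFar κ ((4 / δ) ^ 3) s x₀ s⁻¹ := by
  intro x hx
  obtain ⟨h1, h2⟩ := le_norm_sub_of_le_norm_toBall_sub (h x hx)
  have hs0 : 0 < s := one_pos.trans_le hs
  have h3 : δ / 4 * s ^ 2 ≤ ‖x - x₀‖ := by
    refine le_trans ?_ h2
    rw [hx₀]
    gcongr
    linarith
  -- two of the three factors are estimated by the size of `x₀`, the last one by that of `x`
  calc s * (1 + ‖x‖) =
        (4 / δ) ^ 3 * ((s⁻¹ * (δ / 4 * s ^ 2)) ^ 2 * (s⁻¹ * (δ / 4 * (1 + ‖x‖)))) := by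
        field_simp
    _ ≤ (4 / δ) ^ 3 * ((s⁻¹ * ‖x - x₀‖) ^ 2 * (s⁻¹ * ‖x - x₀‖)) := by gcongr
    _ = _ := by ring

/-! ### Cut-offs with small support -/

theorem exists_schwartz_bump {x₀ : 𝔼} {U : Set 𝔼} (hU : U ∈ 𝓝 x₀) :
    ∃ χ : 𝓢(𝔼, ℂ), HasCompactSupport χ ∧ tsupport χ ⊆ U ∧ (∀ᶠ x in 𝓝 x₀, χ x = 1) ∧
      ∀ x, ‖χ x‖ ≤ 1 := by
  obtain ⟨r, hr, hrU⟩ := Metric.nhds_basis_closedBall.mem_iff.1 hU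
  let b : ContDiffBump x₀ := ⟨r / 2, r, by positivity, by linarith⟩
  have hsupp : HasCompactSupport fun x => ((b x : ℝ) : ℂ) :=
    b.hasCompactSupport.comp_left (g := fun t : ℝ => (t : ℂ)) Complex.ofReal_zero
  have hsm : ContDiff ℝ ∞ fun x => ((b x : ℝ) : ℂ) := Complex.ofRealCLM.contDiff.comp b.contDiff
  refine ⟨hsupp.toSchwartzMap hsm, hsupp, ?_, ?_, fun x => ?_⟩
  · refine Subset.trans ?_ hrU
    refine (closure_mono ?_).trans (b.tsupport_eq.subset)
    intro x hx
    have hx' : ((b x : ℝ) : ℂ) ≠ 0 := hx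
    exact_mod_cast hx'
  · filter_upwards [b.eventuallyEq_one] with x hx
    change ((b x : ℝ) : ℂ) = 1
    rw [hx]
    simp
  · change ‖((b x : ℝ) : ℂ)‖ ≤ 1
    rw [Complex.norm_real, Real.norm_of_nonneg b.nonneg]
    exact b.le_one

theorem exists_bump_support_toBall (x₀ : 𝔼) {δ : ℝ} (hδ : 0 < δ) :
    ∃ χ : 𝓢(𝔼, ℂ), HasCompactSupport χ ∧ (∀ᶠ x in 𝓝 x₀, χ x = 1) ∧
      ∀ x ∈ Function.support χ, ‖toBall x - toBall x₀‖ < δ := by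
  have hU : {x : 𝔼 | ‖toBall x - toBall x₀‖ < δ} ∈ 𝓝 x₀ := by
    have hc : Continuous fun x : 𝔼 => ‖toBall x - toBall x₀‖ :=
      (continuous_toBall.sub continuous_const).norm
    exact (isOpen_lt hc continuous_const).mem_nhds (by simpa using hδ)
  obtain ⟨χ, h1, h2, h3, -⟩ := exists_schwartz_bump hU
  exact ⟨χ, h1, h3, fun x hx => h2 (subset_tsupport _ hx)⟩

/-- The supports of the asymptotic cut-offs which do not vanish in the direction `θ` can be made
arbitrarily small in the compactification. -/
theorem exists_angular_support_toBall {φ : 𝔼 → ℂ} (hφ : IsCutoff φ) {θ : 𝔼} (hθ : ‖θ‖ = 1)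
    {δ : ℝ} (hδ : 0 < δ) :
    ∃ ψ : 𝔼 → ℂ, IsAngular ψ ∧ ψ θ ≠ 0 ∧ ∃ R : ℝ, 0 < R ∧
      ∀ x ∈ Function.support (asympCutoff φ ψ R), ‖toBall x - θ‖ < δ := by
  obtain ⟨r, hr, hr1⟩ := Metric.eventually_nhds_iff_ball.1 hφ.eventually_eq_one
  let b : ContDiffBump θ := ⟨δ / 4, δ / 2, by positivity, by linarith⟩
  refine ⟨fun x => ((b (‖x‖⁻¹ • x) : ℝ) : ℂ), ⟨?_, ?_⟩, ?_, 2 / (δ * r), by positivity, ?_⟩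
  · refine Complex.ofRealCLM.contDiff.comp_contDiffOn (b.contDiff.comp_contDiffOn ?_)
    intro x hx
    exact (((contDiffAt_norm ℝ hx).inv (norm_ne_zero_iff.2 hx)).smul contDiffAt_id).contDiffWithinAt
  · intro t ht x hx
    have : ‖t • x‖⁻¹ • t • x = ‖x‖⁻¹ • x := by
      rw [norm_smul, Real.norm_of_nonneg ht.le, smul_smul, mul_inv, mul_assoc, mul_comm,
        mul_assoc, mul_inv_cancel₀ ht.ne', mul_one]
    rw [this]
  · have : b θ = 1 := b.one_of_mem_closedBall (mem_closedBall_self b.rIn_pos.le)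
    simp [hθ, this]
  · intro x hx
    have hx' : (1 - φ ((2 / (δ * r))⁻¹ • x)) * ((b (‖x‖⁻¹ • x) : ℝ) : ℂ) ≠ 0 := hx
    have h1 : 1 - φ ((2 / (δ * r))⁻¹ • x) ≠ 0 := left_ne_zero_of_mul hx'
    have h2 : b (‖x‖⁻¹ • x) ≠ 0 := by exact_mod_cast right_ne_zero_of_mul hx'
    have h3 : 2 / δ ≤ ‖x‖ := by
      by_contra hlt
      push Not at hlt
      refine h1 ?_
      rw [hr1, sub_self]
      rw [mem_ball_zero_iff, norm_smul, norm_inv, Real.norm_of_nonneg (by positivity),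
        inv_mul_lt_iff₀ (by positivity)]
      calc ‖x‖ < 2 / δ := hlt
        _ = _ := by field_simp
    have h4 : 0 < ‖x‖ := lt_of_lt_of_le (by positivity) h3
    have h5 : ‖‖x‖⁻¹ • x - θ‖ < δ / 2 := by
      by_contra hge
      push Not at hge
      exact h2 (b.zero_of_le_dist (by rw [dist_eq_norm]; exact hge))
    have h6 : ‖toBall x - ‖x‖⁻¹ • x‖ ≤ δ / 2 := by
      have := norm_toBall_smul_sub_le h4 (θ := ‖x‖⁻¹ • x)
        (by rw [norm_smul, norm_inv, norm_norm, inv_mul_cancel₀ h4.ne'])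
      rw [smul_inv_smul₀ h4.ne'] at this
      refine this.trans ?_
      calc ‖x‖⁻¹ ≤ (2 / δ)⁻¹ := inv_anti₀ (by positivity) h3
        _ = δ / 2 := inv_div _ _
    calc ‖toBall x - θ‖ = ‖(toBall x - ‖x‖⁻¹ • x) + (‖x‖⁻¹ • x - θ)‖ := by congr 1; abel
      _ ≤ _ := norm_add_le _ _
      _ < δ := by linarith

/-! ### The wave front set is contained in the limit set of the packets -/

namespace PacketFamily

/-- The localization of the `k`-th packet to a region of phase space is uniformly `O(1 / s k)`, as
soon as the center of the packet is outside of this region. -/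
theorem exists_schwartzNorm_localize_term_le (D : PacketFamily d) {m κ : 𝔼 → ℂ} (hm : IsSymbol m)
    (hκ : IsSymbol κ) {δ : ℝ} (hδ : 0 < δ) (q : ℕ) : ∃ C : ℝ, ∀ k,
      (k ∈ D.highFreq ∪ D.farOut →
        (∀ x ∈ Function.support m, δ ≤ ‖toBall x - toBall (D.x k)‖) ∨
        (∀ ξ ∈ Function.support κ, δ ≤ ‖toBall ξ - toBall (D.ξ k)‖)) →
      (D.s k : ℝ) * schwartzNorm q (SchwartzMap.smulLeftCLM ℂ κ
        (fourierSchwartz d (SchwartzMap.smulLeftCLM ℂ m (D.term k)))) ≤ C := by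
  obtain ⟨C₁, h₁⟩ := exists_schwartzNorm_localize_packet_le hm hκ
    (C₀ := (4 / δ) ^ 3) (by positivity) D.ρ q 1
  obtain ⟨C₂, h₂⟩ := exists_schwartzNorm_localize_packet_le hm hκ
    (C₀ := (4 / δ) ^ 3) (by positivity) (fourierSchwartz d D.ρ) q (1 + d)
  refine ⟨max (max C₁ C₂) 0, fun k hk => ?_⟩
  have h4 := D.four_le_s k
  have hs : (1 : ℝ) ≤ D.s k := by linarith
  have hs0 := D.s_pos k
  have hinv : ((D.s k : ℝ))⁻¹ ≤ D.s k := (inv_le_one_of_one_le₀ hs).trans hs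
  by_cases hB : k ∈ D.farOut
  · refine le_trans ?_ ((le_max_left _ _).trans (le_max_left _ _))
    have hfar := hk (Or.inr hB)
    rw [term_of_farOut D hB]
    have := h₁ (D.s k) (D.x k) (D.ξ k) (D.s k)⁻¹ hs
    simp only [Units.val_inv_eq_inv_val, inv_inv, pow_one] at this
    refine this (by positivity) hinv le_rfl (D.norm_x_le k) (D.norm_ξ_le k)
      (by rw [D.norm_x k hB]; linarith) ?_
    exact hfar.imp (isFar_wide hδ hs (D.norm_x k hB)) (isFar_narrow hδ hs)
  by_cases hA : k ∈ D.highFreq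
  · refine le_trans ?_ ((le_max_right _ _).trans (le_max_left _ _))
    have hfar := hk (Or.inl hA)
    rw [term_of_highFreq D hA, fourierSchwartz_packet]
    simp only [map_smul, map_smul_eq_mul, norm_mul, norm_planeWave, neg_neg, one_mul, inv_inv,
      Units.val_inv_eq_inv_val, Complex.norm_real, norm_inv, norm_abs_eq_norm, norm_pow,
      Real.norm_of_nonneg hs0.le, inv_pow]
    have := h₂ (D.s k) (D.x k) (D.ξ k) (D.s k) hs hs0 le_rfl hinv (D.norm_x_le k) (D.norm_ξ_le k)
      (by
        have : ((D.s k : ℝ)⁻¹) ^ 2 ≤ 1 := pow_le_one₀ (by positivity) (inv_le_one_of_one_le₀ hs)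
        linarith [norm_nonneg (D.x k)])
      (hfar.imp (isFar_narrow hδ hs) (isFar_wide hδ hs (D.norm_ξ k hA)))
    rwa [pow_add, pow_one, mul_assoc] at this
  · rw [term_of_notMem D hB hA]
    simp

/-- If the packets avoid the region of phase space selected by the cut-offs `m` and `κ`, then
`κ · F(m · T)` is a Schwartz function, for the sum `T` of the packets. -/
theorem exists_localize_distr_eq (D : PacketFamily d) {m κ : 𝔼 → ℂ} (hm : IsSymbol m)
    (hκ : IsSymbol κ) {δ : ℝ} (hδ : 0 < δ)
    (h : ∀ᶠ k in Filter.atTop, k ∈ D.highFreq ∪ D.farOut →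
      (∀ x ∈ Function.support m, δ ≤ ‖toBall x - toBall (D.x k)‖) ∨
      (∀ ξ ∈ Function.support κ, δ ≤ ‖toBall ξ - toBall (D.ξ k)‖)) :
    ∃ w : 𝓢(𝔼, ℂ), (∀ f : 𝓢(𝔼, ℂ), D.distr (SchwartzMap.smulLeftCLM ℂ m
        (fourierSchwartz d (SchwartzMap.smulLeftCLM ℂ κ f))) = ∫ ξ, w ξ * f ξ) ∧
      ∀ χ : 𝓢(𝔼, ℂ), ⇑χ = m → ∀ ξ, κ ξ * localFourier D.distr χ ξ = w ξ := by
  have hmT := hm.hasTemperateGrowth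
  have hκT := hκ.hasTemperateGrowth
  set W : ℕ → 𝓢(𝔼, ℂ) := fun k => SchwartzMap.smulLeftCLM ℂ κ
    (fourierSchwartz d (SchwartzMap.smulLeftCLM ℂ m (D.term k))) with hW
  have hsum : ∀ p n, Summable fun k => SchwartzMap.seminorm ℂ p n (W k) := by
    intro p n
    obtain ⟨C, hC⟩ := D.exists_schwartzNorm_localize_term_le hm hκ hδ (max p n)
    refine Summable.of_norm_bounded_eventually_nat (D.summable_inv_s.mul_left C) ?_
    filter_upwards [h] with k hk
    rw [Real.norm_of_nonneg (apply_nonneg _ _), ← div_eq_mul_inv, le_div_iff₀' (D.s_pos k)]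
    refine le_trans ?_ (hC k hk)
    exact mul_le_mul_of_nonneg_left
      (seminorm_le_schwartzNorm (le_max_left _ _) (le_max_right _ _) _) (D.s_pos k).le
  obtain ⟨w, hw, hwf⟩ := exists_schwartz_hasSum hsum
  refine ⟨w, fun f => ?_, fun χ hχ ξ => ?_⟩
  · refine (D.hasSum_distr _).unique ((hwf f).congr_fun fun k => ?_)
    calc ∫ x, D.term k x * SchwartzMap.smulLeftCLM ℂ m
          (fourierSchwartz d (SchwartzMap.smulLeftCLM ℂ κ f)) x
        = ∫ x, SchwartzMap.smulLeftCLM ℂ m (D.term k) x *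
          fourierSchwartz d (SchwartzMap.smulLeftCLM ℂ κ f) x := by
          congr 1; ext x
          simp only [SchwartzMap.smulLeftCLM_apply_apply hmT, smul_eq_mul]
          ring
      _ = ∫ ξ, fourierSchwartz d (SchwartzMap.smulLeftCLM ℂ m (D.term k)) ξ *
          SchwartzMap.smulLeftCLM ℂ κ f ξ := (integral_fourierSchwartz_mul _ _).symm
      _ = ∫ ξ, W k ξ * f ξ := by
          congr 1; ext ξ
          simp only [hW, SchwartzMap.smulLeftCLM_apply_apply hκT, smul_eq_mul]
          ring
  · refine ((D.hasSum_distr _).mul_left (κ ξ)).unique ((hw ξ).congr_fun fun k => ?_)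
    simp only [hW, SchwartzMap.smulLeftCLM_apply_apply hκT, smul_eq_mul, fourierSchwartz_apply]
    congr 2; ext x
    rw [SchwartzMap.smulLeftCLM_apply_apply hmT,
      SchwartzMap.smulLeftCLM_apply_apply (planeWave_hasTemperateGrowth ξ), ← hχ]
    simp only [smul_eq_mul]
    ring

theorem smulLeftCLM_planeWave (ξ : 𝔼) (χ : 𝓢(𝔼, ℂ)) :
    SchwartzMap.smulLeftCLM ℂ (planeWave ξ) χ = phaseShift 0 (-ξ) χ := by
  ext x
  simp [phaseShift_apply, SchwartzMap.smulLeftCLM_apply_apply (planeWave_hasTemperateGrowth ξ)]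

theorem integral_norm_phaseShift (x₀ ξ₀ : 𝔼) (f : 𝓢(𝔼, ℂ)) :
    ∫ x, ‖phaseShift x₀ ξ₀ f x‖ = ∫ x, ‖f x‖ := by
  simp only [phaseShift_apply, norm_mul, norm_planeWave, one_mul]
  exact integral_sub_right_eq_self (fun x => ‖f x‖) x₀

theorem norm_localFourier_distr_le (D : PacketFamily d) (χ : 𝓢(𝔼, ℂ)) (ξ : 𝔼) :
    ‖localFourier D.distr χ ξ‖ ≤ (∫ x, ‖χ x‖) + ∫ ξ, ‖fourierSchwartz d χ ξ‖ := by
  rw [localFourier, smulLeftCLM_planeWave]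
  refine (D.norm_distr_apply_le _).trans_eq ?_
  rw [fourierSchwartz_phaseShift]
  simp only [smul_apply, norm_smul, norm_planeWave, one_mul]
  rw [integral_norm_phaseShift, integral_norm_phaseShift]

theorem notMem_classicalWF_distr (D : PacketFamily d) {φ : 𝔼 → ℂ} (hφ : IsCutoff φ) {x₀ η : 𝔼}
    (hη : ‖η‖ = 1) {ε : ℝ} (hε : 0 < ε)
    (h : ∀ᶠ k in Filter.atTop, k ∈ D.highFreq ∪ D.farOut →
      ε ≤ ‖toBall (D.x k) - toBall x₀‖ ∨ ε ≤ ‖toBall (D.ξ k) - η‖) :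
    (x₀, η) ∉ classicalWF D.distr := by
  obtain ⟨χ, hχc, hχ1, hχs⟩ := exists_bump_support_toBall x₀ (half_pos hε)
  obtain ⟨ψ, hψ, hψη, R, hR, hψs⟩ := exists_angular_support_toBall hφ hη (half_pos hε)
  obtain ⟨w, -, hw⟩ := D.exists_localize_distr_eq
    (isSymbol_of_hasCompactSupport (χ.smooth ⊤) hχc) (isSymbol_asympCutoff hφ hψ hR)
    (half_pos hε) (by
      filter_upwards [h] with k hk hkS
      refine (hk hkS).imp (fun hk x hx => ?_) (fun hk ξ hξ => ?_)
      · have h1 := hχs x hx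
        have h2 := norm_sub_le_norm_sub_add_norm_sub (toBall (D.x k)) (toBall x) (toBall x₀)
        rw [norm_sub_rev (toBall (D.x k)) (toBall x)] at h2
        linarith
      · have h1 := hψs ξ hξ
        have h2 := norm_sub_le_norm_sub_add_norm_sub (toBall (D.ξ k)) (toBall ξ) η
        rw [norm_sub_rev (toBall (D.ξ k)) (toBall ξ)] at h2
        linarith)
  have hw' := hw χ rfl
  have hη0 : η ≠ 0 := by rintro rfl; simp at hη
  intro hmem
  refine hmem.2 ⟨χ, hχc, by rw [hχ1.self_of_nhds]; exact one_ne_zero,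
    {0}ᶜ ∩ ψ ⁻¹' {z | ‖ψ η‖ / 2 < ‖z‖}, ?_, ?_, ⟨hη0, ?_⟩, fun N => ?_⟩
  · exact hψ.contDiffOn.continuousOn.isOpen_inter_preimage isOpen_compl_singleton
      (isOpen_lt continuous_const continuous_norm)
  · rintro t ht ξ ⟨hξ0, hξ⟩
    refine ⟨smul_ne_zero ht.ne' hξ0, ?_⟩
    rw [mem_preimage, hψ.homogeneous t ht ξ hξ0]
    exact hξ
  · have : 0 < ‖ψ η‖ := norm_pos_iff.2 hψη
    simp only [mem_preimage, mem_ofPred_eq]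
    linarith
  · obtain ⟨r, hr⟩ := hφ.hasCompactSupport.isCompact.isBounded.subset_closedBall 0
    set B := (∫ x, ‖χ x‖) + ∫ ξ, ‖fourierSchwartz d χ ξ‖ with hB
    set Q := 2 ^ N * (Finset.Iic (N, 0)).sup (schwartzSeminormFamily ℂ 𝔼 ℂ) w with hQ
    have hψ0 : 0 < ‖ψ η‖ := norm_pos_iff.2 hψη
    refine ⟨max ((1 + R * r) ^ N * B) (Q / (‖ψ η‖ / 2)), ?_⟩
    rintro ξ ⟨hξ0, hξ⟩
    rw [mem_preimage, mem_ofPred_eq] at hξ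
    by_cases hφξ : φ (R⁻¹ • ξ) = 0
    · -- outside of the support of `φ(· / R)`, the local Fourier transform is `w / ψ`
      refine le_trans ?_ (le_max_right _ _)
      rw [le_div_iff₀ (by positivity)]
      have h1 := hw' ξ
      rw [asympCutoff, hφξ, sub_zero, one_mul] at h1
      have h2 := SchwartzMap.one_add_le_sup_seminorm_apply (𝕜 := ℂ) (m := (N, 0)) (k := N)
        (n := 0) le_rfl le_rfl w ξ
      rw [norm_iteratedFDeriv_zero, ← h1, norm_mul] at h2
      refine le_trans ?_ h2
      calc _ = (1 + ‖ξ‖) ^ N * (‖ψ η‖ / 2 * ‖localFourier D.distr χ ξ‖) := by ring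
        _ ≤ _ := by gcongr
    · refine le_trans ?_ (le_max_left _ _)
      have h1 : ‖ξ‖ ≤ R * r := by
        have := hr (subset_tsupport _ (Function.mem_support.2 hφξ))
        rwa [mem_closedBall_zero_iff, norm_smul, norm_inv, Real.norm_of_nonneg hR.le,
          inv_mul_le_iff₀ hR] at this
      have h2 := D.norm_localFourier_distr_le χ ξ
      have h0 : 0 ≤ 1 + R * r := by linarith [norm_nonneg ξ]
      exact mul_le_mul (pow_le_pow_left₀ (by positivity) (by linarith) N) h2 (norm_nonneg _)
        (pow_nonneg h0 N)

/-- The wave front set of the sum of the packets only contains limit points of the packets. -/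
theorem notMem_globalWF_distr (D : PacketFamily d) {φ : 𝔼 → ℂ} (hφ : IsCutoff φ) {p : 𝔼 × 𝔼}
    {ε : ℝ} (hε : 0 < ε)
    (h : ∀ᶠ k in Filter.atTop, k ∈ D.highFreq ∪ D.farOut →
      ε ≤ ‖toBall (D.x k) - p.1‖ ∨ ε ≤ ‖toBall (D.ξ k) - p.2‖) :
    p ∉ globalWF φ D.distr := by
  rintro (⟨⟨x₀, η⟩, hmem, rfl⟩ | ⟨hp1, -, hp⟩)
  · exact D.notMem_classicalWF_distr hφ (mem_sphere_zero_iff_norm.1 hmem.1) hε h hmem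
  rw [mem_sphere_zero_iff_norm] at hp1
  obtain ⟨ψ, hψ, hψη, R, hR, hψs⟩ := exists_angular_support_toBall hφ hp1 (half_pos hε)
  have hm := isSymbol_asympCutoff hφ hψ hR
  refine hp ⟨ψ, hψ, hψη, R, hR, ?_⟩
  have hloc : ∀ {κ : 𝔼 → ℂ}, (∀ ξ ∈ Function.support κ, ‖toBall ξ - p.2‖ < ε / 2) →
      ∀ᶠ k in Filter.atTop, k ∈ D.highFreq ∪ D.farOut →
        (∀ x ∈ Function.support (asympCutoff φ ψ R), ε / 2 ≤ ‖toBall x - toBall (D.x k)‖) ∨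
        (∀ ξ ∈ Function.support κ, ε / 2 ≤ ‖toBall ξ - toBall (D.ξ k)‖) := by
    intro κ hκ
    filter_upwards [h] with k hk hkS
    refine (hk hkS).imp (fun hk x hx => ?_) (fun hk ξ hξ => ?_)
    · have h1 := hψs x hx
      have h2 := norm_sub_le_norm_sub_add_norm_sub (toBall (D.x k)) (toBall x) p.1
      rw [norm_sub_rev (toBall (D.x k)) (toBall x)] at h2
      linarith
    · have h1 := hκ ξ hξ
      have h2 := norm_sub_le_norm_sub_add_norm_sub (toBall (D.ξ k)) (toBall ξ) p.2
      rw [norm_sub_rev (toBall (D.ξ k)) (toBall ξ)] at h2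
      linarith
  rintro (⟨ξ₀, hξ₀, hξp⟩ | ⟨hθ, hθ'⟩)
  · obtain ⟨χ, hχc, hχ1, hχs⟩ := exists_bump_support_toBall ξ₀ (half_pos hε)
    rw [hξp] at hχs
    obtain ⟨w, hw, -⟩ := D.exists_localize_distr_eq hm
      (isSymbol_of_hasCompactSupport (χ.smooth ⊤) hχc) (half_pos hε) (hloc hχs)
    obtain ⟨U, hU, hUo, hξU⟩ := _root_.eventually_nhds_iff.1 hχ1
    refine hξ₀ ⟨U, hUo, hξU, w, (w.smooth ⊤).contDiffOn, fun f _ hf => ?_⟩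
    rw [← hw f]
    -- `χ f = f`, since `χ = 1` on the support of `f`
    have hχf : SchwartzMap.smulLeftCLM ℂ χ f = f := by
      ext ξ
      rw [SchwartzMap.smulLeftCLM_apply_apply χ.hasTemperateGrowth]
      by_cases hξ : ξ ∈ U
      · rw [hU ξ hξ, one_smul]
      · have : f ξ = 0 := by
          by_contra hne
          exact hξ (hf (subset_tsupport _ hne))
        rw [this, smul_zero]
    rw [hχf]
    rfl
  · rw [mem_sphere_zero_iff_norm] at hθ
    obtain ⟨ψ', hψ', hψη', R', hR', hψs'⟩ := exists_angular_support_toBall hφ hθ (half_pos hε)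
    obtain ⟨w, hw, -⟩ := D.exists_localize_distr_eq hm (isSymbol_asympCutoff hφ hψ' hR')
      (half_pos hε) (hloc hψs')
    exact hθ' ⟨R', hR', ψ', hψ', hψη', w, hw⟩

end PacketFamily

/-! ### The limit set of the packets is contained in the wave front set -/

theorem tendsto_integral_norm_sub {ι : Type*} {l : Filter ι} {G : ι → 𝓢(𝔼, ℂ)} {G₀ : 𝓢(𝔼, ℂ)}
    (hG : Filter.Tendsto G l (𝓝 G₀)) :
    Filter.Tendsto (fun k => ∫ x, ‖G k x - G₀ x‖) l (𝓝 0) := by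
  have h1 : Filter.Tendsto (fun k => G k - G₀) l (𝓝 0) := by simpa using hG.sub_const G₀
  have h2 := (((SchwartzMap.toLpCLM ℂ ℂ 1 (volume : Measure 𝔼)).continuous.tendsto 0).comp h1).norm
  rw [map_zero, norm_zero] at h2
  refine h2.congr fun k => ?_
  simp only [Function.comp, SchwartzMap.toLpCLM_apply]
  rw [L1.norm_eq_integral_norm]
  refine integral_congr_ae ?_
  filter_upwards [(G k - G₀).coeFn_toLp 1 volume] with x hx
  rw [hx]
  rfl

/-- Against uniformly bounded factors, a convergent family of Schwartz functions may be replaced by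
its limit. -/
theorem tendsto_integral_mul_of_tendsto {ι : Type*} {l : Filter ι} {h : ι → 𝔼 → ℂ}
    (hm : ∀ k, AEStronglyMeasurable (h k)) {C : ℝ} (hb : ∀ k x, ‖h k x‖ ≤ C)
    {G : ι → 𝓢(𝔼, ℂ)} {G₀ : 𝓢(𝔼, ℂ)} (hG : Filter.Tendsto G l (𝓝 G₀)) {a : ℂ}
    (ha : Filter.Tendsto (fun k => ∫ x, h k x * G₀ x) l (𝓝 a)) :
    Filter.Tendsto (fun k => ∫ x, h k x * G k x) l (𝓝 a) := by
  have hint : ∀ k (f : 𝓢(𝔼, ℂ)), Integrable fun x => h k x * f x := fun k f =>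
    f.integrable.bdd_mul (hm k) (.of_forall (hb k))
  have h1 : Filter.Tendsto (fun k => ∫ x, h k x * (G k - G₀) x) l (𝓝 0) := by
    refine squeeze_zero_norm (a := fun k => C * ∫ x, ‖G k x - G₀ x‖) (fun k => ?_)
      (by simpa using (tendsto_integral_norm_sub hG).const_mul C)
    rw [← integral_const_mul]
    refine norm_integral_le_of_norm_le ((G k - G₀).integrable.norm.const_mul C)
      (.of_forall fun x => ?_)
    rw [norm_mul]
    exact mul_le_mul_of_nonneg_right (hb k x) (norm_nonneg _)
  have h2 := h1.add ha
  rw [zero_add] at h2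
  refine h2.congr fun k => ?_
  rw [← integral_add (hint k _) (hint k _)]
  congr 1; ext x
  rw [sub_apply]
  ring

theorem tendsto_integral_mul_of_tendsto_pointwise {ι : Type*} {l : Filter ι}
    [l.IsCountablyGenerated] {h : ι → 𝔼 → ℂ} (hm : ∀ k, AEStronglyMeasurable (h k)) {C : ℝ}
    (hb : ∀ k x, ‖h k x‖ ≤ C) {h₀ : 𝔼 → ℂ}
    (hlim : ∀ x : 𝔼, Filter.Tendsto (fun k => h k x) l (𝓝 (h₀ x)))
    {G : ι → 𝓢(𝔼, ℂ)} {G₀ : 𝓢(𝔼, ℂ)} (hG : Filter.Tendsto G l (𝓝 G₀)) :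
    Filter.Tendsto (fun k => ∫ x, h k x * G k x) l (𝓝 (∫ x, h₀ x * G₀ x)) := by
  refine tendsto_integral_mul_of_tendsto hm hb hG ?_
  refine tendsto_integral_filter_of_dominated_convergence (fun x => C * ‖G₀ x‖)
    (.of_forall fun k => (hm k).mul G₀.continuous.aestronglyMeasurable)
    (.of_forall fun k => .of_forall fun x => ?_) (G₀.integrable.norm.const_mul C)
    (.of_forall fun x => (hlim x).mul_const _)
  rw [norm_mul]
  exact mul_le_mul_of_nonneg_right (hb k x) (norm_nonneg _)

theorem tendsto_cocompact_of_norm {ι : Type*} {l : Filter ι} {y : ι → 𝔼}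
    (hy : Filter.Tendsto (fun k => ‖y k‖) l Filter.atTop) :
    Filter.Tendsto y l (Filter.cocompact 𝔼) := by
  rwa [← cobounded_eq_cocompact, ← tendsto_norm_atTop_iff_cobounded]

/-- The Riemann-Lebesgue lemma, with a factor which varies in the Schwartz space. -/
theorem tendsto_integral_mul_planeWave {ι : Type*} {l : Filter ι} {h : 𝔼 → ℂ}
    (hm : AEStronglyMeasurable h) {C : ℝ} (hb : ∀ x, ‖h x‖ ≤ C) {ξ : ι → 𝔼}
    (hξ : Filter.Tendsto (fun k => ‖ξ k‖) l Filter.atTop)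
    {G : ι → 𝓢(𝔼, ℂ)} {G₀ : 𝓢(𝔼, ℂ)} (hG : Filter.Tendsto G l (𝓝 G₀)) :
    Filter.Tendsto (fun k => ∫ x, h x * planeWave (ξ k) x * G k x) l (𝓝 0) := by
  refine tendsto_integral_mul_of_tendsto (h := fun k x => h x * planeWave (ξ k) x)
    (fun k => hm.mul (continuous_planeWave _).aestronglyMeasurable) (C := C)
    (fun k x => by rw [norm_mul, norm_planeWave, mul_one]; exact hb x) hG ?_
  refine ((tendsto_integral_planeWave_mul (fun x => h x * G₀ x)).comp
    (tendsto_cocompact_of_norm hξ)).congr fun k => ?_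
  simp only [Function.comp]
  congr 1; ext x
  ring

theorem tendsto_planeWave {ι : Type*} {l : Filter ι} {ξ : ι → 𝔼} {ξ₀ : 𝔼}
    (hξ : Filter.Tendsto ξ l (𝓝 ξ₀)) (x : 𝔼) :
    Filter.Tendsto (fun k => planeWave (ξ k) x) l (𝓝 (planeWave ξ₀ x)) := by
  simp only [planeWave_comm _ x]
  exact ((continuous_planeWave x).tendsto ξ₀).comp hξ

theorem smulLeftCLM_phaseShift {m : 𝔼 → ℂ} (hm : m.HasTemperateGrowth) (x₀ ξ₀ : 𝔼) (f : 𝓢(𝔼, ℂ)) :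
    SchwartzMap.smulLeftCLM ℂ m (phaseShift x₀ ξ₀ f) =
      phaseShift x₀ ξ₀ (SchwartzMap.smulLeftCLM ℂ (fun z => m (x₀ + z)) f) := by
  have hm' : (fun z => m (x₀ + z)).HasTemperateGrowth := by
    simpa using hasTemperateGrowth_comp_affine hm x₀ 1
  ext x
  simp only [SchwartzMap.smulLeftCLM_apply_apply hm, SchwartzMap.smulLeftCLM_apply_apply hm',
    phaseShift_apply, smul_eq_mul, add_sub_cancel]
  ring

namespace PacketFamily

theorem distr_phaseShift (D : PacketFamily d) (x ξ : 𝔼) (f : 𝓢(𝔼, ℂ)) :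
    D.distr (phaseShift x ξ f) =
      planeWave (-ξ) x * (∫ z, D.farPart (x + z) * planeWave (-ξ) z * f z) +
        ∫ z, D.freqPart (ξ + z) * planeWave x z * fourierSchwartz d f z := by
  rw [distr_apply, fourierSchwartz_phaseShift, ← integral_const_mul]
  congr 1
  · rw [← integral_add_left_eq_self _ x]
    congr 1; ext z
    rw [phaseShift_apply, add_sub_cancel_left, planeWave_add_right]
    ring
  · rw [← integral_add_left_eq_self _ ξ]
    congr 1; ext z
    rw [smul_apply, phaseShift_apply, add_sub_cancel_left, neg_neg, planeWave_add_right,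
      smul_eq_mul]
    linear_combination D.freqPart (ξ + z) * planeWave x z * fourierSchwartz d f z *
      planeWave_neg_mul x ξ

variable {D : PacketFamily d} {l : Filter ℕ}

/-- Each packet looks like a plane wave around its center. -/
theorem tendsto_planeWave_mul_lacunarySum (hl : l ≤ Filter.atTop) {S : Set ℕ}
    {y : ℕ → EuclideanSpace ℝ (Fin d)} (hy : ∀ k ∈ S, ‖y k‖ = (D.s k : ℝ) ^ 2)
    (η : ℕ → EuclideanSpace ℝ (Fin d)) (hS : ∀ᶠ k in l, k ∈ S) (z : EuclideanSpace ℝ (Fin d)) :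
    Filter.Tendsto (fun k => planeWave (η k) (y k + z) * D.lacunarySum S y η (y k + z)) l
      (𝓝 1) := by
  have h1 : Filter.Tendsto (fun k => D.ρ ((D.s k : ℝ)⁻¹ • z)) l (𝓝 1) := by
    rw [← D.ρ_zero]
    refine (D.ρ.continuous.tendsto 0).comp ?_
    simpa using (tendsto_inv_atTop_zero.comp (D.tendsto_s.mono_left hl)).smul_const z
  refine h1.congr' ?_
  have h2 := (Filter.tendsto_atTop.1 (D.tendsto_s_sq.mono_left hl)) (4 * ‖z‖)
  filter_upwards [hS, h2] with k hk hz
  rw [D.lacunarySum_add hy η (hy k hk) (by linarith), Set.indicator_of_mem hk, packet_apply,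
    add_sub_cancel_left, ← mul_assoc, planeWave_mul_neg, one_mul, Units.val_inv_eq_inv_val]

theorem tendsto_lacunarySum_zero (hl : l ≤ Filter.atTop) {S : Set ℕ}
    {y : ℕ → EuclideanSpace ℝ (Fin d)} (hy : ∀ k ∈ S, ‖y k‖ = (D.s k : ℝ) ^ 2)
    (η : ℕ → EuclideanSpace ℝ (Fin d)) (hS : ∀ᶠ k in l, k ∉ S) {p : ℕ → EuclideanSpace ℝ (Fin d)}
    (hp : ∀ᶠ k in l, ‖p k‖ = (D.s k : ℝ) ^ 2) (z : EuclideanSpace ℝ (Fin d)) :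
    Filter.Tendsto (fun k => D.lacunarySum S y η (p k + z)) l (𝓝 0) := by
  refine tendsto_const_nhds.congr' ?_
  have h2 := (Filter.tendsto_atTop.1 (D.tendsto_s_sq.mono_left hl)) (4 * ‖z‖)
  filter_upwards [hS, hp, h2] with k hk hpk hz
  rw [D.lacunarySum_add hy η hpk (by linarith), Set.indicator_of_notMem hk]

theorem measurable_farPart (D : PacketFamily d) : Measurable D.farPart :=
  D.measurable_lacunarySum D.norm_x D.ξ

theorem measurable_freqPart (D : PacketFamily d) : Measurable D.freqPart :=
  D.measurable_lacunarySum D.norm_neg_ξ D.x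

theorem norm_farPart_le (D : PacketFamily d) (x : 𝔼) : ‖D.farPart x‖ ≤ 1 :=
  D.norm_lacunarySum_le D.norm_x D.ξ x

theorem norm_freqPart_le (D : PacketFamily d) (x : 𝔼) : ‖D.freqPart x‖ ≤ 1 :=
  D.norm_lacunarySum_le D.norm_neg_ξ D.x x

theorem tendsto_norm_of_eventually_eq (hl : l ≤ Filter.atTop) {y : ℕ → EuclideanSpace ℝ (Fin d)}
    (hy : ∀ᶠ k in l, ‖y k‖ = (D.s k : ℝ) ^ 2) :
    Filter.Tendsto (fun k => ‖y k‖) l Filter.atTop :=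
  (D.tendsto_s_sq.mono_left hl).congr' (by filter_upwards [hy] with k hk using hk.symm)

/-- At a limit of packets of high frequency with bounded positions, the local Fourier transform of
the sum of the packets does not tend to `0`. -/
theorem tendsto_localFourier [l.IsCountablyGenerated] (hl : l ≤ Filter.atTop)
    (hk : ∀ᶠ k in l, k ∈ D.highFreq) {x₀ : EuclideanSpace ℝ (Fin d)}
    (hx : Filter.Tendsto D.x l (𝓝 x₀)) (χ : 𝓢(EuclideanSpace ℝ (Fin d), ℂ)) :
    Filter.Tendsto (fun k => planeWave (D.x k) (-D.ξ k) * localFourier D.distr χ (D.ξ k)) l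
      (𝓝 (((2 * Real.pi) ^ d : ℝ) * χ x₀)) := by
  have hξ := tendsto_norm_of_eventually_eq hl (hk.mono D.norm_ξ)
  -- the far part is treated with the Riemann-Lebesgue lemma
  have h1 : Filter.Tendsto (fun k => planeWave (D.x k) (-D.ξ k) *
      ∫ z, D.farPart z * planeWave (D.ξ k) z * χ z) l (𝓝 0) := by
    have := tendsto_integral_mul_planeWave D.measurable_farPart.aestronglyMeasurable
      D.norm_farPart_le hξ (tendsto_const_nhds (x := χ))
    refine squeeze_zero_norm (fun k => ?_) (tendsto_zero_iff_norm_tendsto_zero.1 this)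
    rw [norm_mul, norm_planeWave, one_mul]
  have h2 := tendsto_integral_mul_of_tendsto_pointwise (l := l) (C := 1)
    (h := fun k z => planeWave (D.x k) (-D.ξ k + z) * D.freqPart (-D.ξ k + z) *
      planeWave (-D.x k) z) (h₀ := planeWave (-x₀)) (G := fun _ => fourierSchwartz d χ)
    (fun k => (((continuous_planeWave _).measurable.comp (measurable_const_add _)).mul
      (D.measurable_freqPart.comp (measurable_const_add _))).mul
        (continuous_planeWave _).measurable |>.aestronglyMeasurable)
    (fun k z => by
      rw [norm_mul, norm_mul, norm_planeWave, norm_planeWave, one_mul, mul_one]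
      exact D.norm_freqPart_le _)
    (fun z => by
      have := (tendsto_planeWave_mul_lacunarySum hl D.norm_neg_ξ D.x hk z).mul
        (tendsto_planeWave hx.neg z)
      rwa [one_mul] at this) tendsto_const_nhds
  rw [integral_planeWave_mul_fourierSchwartz] at h2
  have h3 := h1.add h2
  rw [zero_add] at h3
  refine h3.congr fun k => ?_
  rw [localFourier, smulLeftCLM_planeWave, distr_phaseShift, mul_add, neg_neg,
    planeWave_zero_right, one_mul, ← integral_const_mul (planeWave (D.x k) (-D.ξ k))
      (fun z => D.freqPart (-D.ξ k + z) * planeWave 0 z * fourierSchwartz d χ z)]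
  simp only [zero_add]
  congr 2; ext z
  rw [planeWave_add_right, planeWave_zero_left]
  linear_combination planeWave (D.x k) (-D.ξ k) * D.freqPart (-D.ξ k + z) *
    fourierSchwartz d χ z * planeWave_mul_neg (D.x k) z

/-- A limit of packets of high frequency, with bounded positions, lies in the wave front set. -/
theorem mem_globalWF_of_highFreq [l.NeBot] [l.IsCountablyGenerated] (hl : l ≤ Filter.atTop)
    (hk : ∀ᶠ k in l, k ∈ D.highFreq) {x₀ η : EuclideanSpace ℝ (Fin d)} (hη : ‖η‖ = 1)
    (hx : Filter.Tendsto D.x l (𝓝 x₀))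
    (hξ : Filter.Tendsto (fun k => ((D.s k : ℝ) ^ 2)⁻¹ • D.ξ k) l (𝓝 η))
    (φ : EuclideanSpace ℝ (Fin d) → ℂ) :
    (toBall x₀, η) ∈ globalWF φ D.distr := by
  refine Or.inl ⟨(x₀, η), ⟨mem_sphere_zero_iff_norm.2 hη, ?_⟩, rfl⟩
  rintro ⟨χ, -, hχ, V, hVo, hVc, hηV, hV⟩
  obtain ⟨C, hC⟩ := hV 1
  have hn := tendsto_norm_of_eventually_eq hl (hk.mono D.norm_ξ)
  have h1 := (D.tendsto_localFourier hl hk hx χ).norm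
  have h2 : Filter.Tendsto (fun k => ‖planeWave (D.x k) (-D.ξ k) *
      localFourier D.distr χ (D.ξ k)‖) l (𝓝 0) := by
    refine squeeze_zero' (.of_forall fun _ => norm_nonneg _) ?_
      (g := fun k => C * (1 + ‖D.ξ k‖)⁻¹) ?_
    · filter_upwards [hξ (hVo.mem_nhds hηV)] with k hk
      have hs : (0 : ℝ) < (D.s k : ℝ) ^ 2 := pow_pos (D.s_pos k) 2
      have := hVc _ hs _ hk
      rw [smul_inv_smul₀ hs.ne'] at this
      have := hC _ this
      rw [norm_mul, norm_planeWave, one_mul, ← div_eq_mul_inv, le_div_iff₀ (by positivity)]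
      linarith
    · simpa using (tendsto_inv_atTop_zero.comp
        (Filter.tendsto_atTop_add_const_left _ 1 hn)).const_mul C
  have h3 := tendsto_nhds_unique h1 h2
  rw [norm_eq_zero, mul_eq_zero] at h3
  refine h3.elim (fun h => ?_) hχ
  have : ((2 * Real.pi) ^ d : ℝ) ≠ 0 := by positivity
  exact this (by exact_mod_cast h)

/-- A limit of packets which are far out, with bounded frequencies, lies in the wave front set. -/
theorem mem_globalWF_of_farOut [l.NeBot] [l.IsCountablyGenerated] (hl : l ≤ Filter.atTop)
    (hk : ∀ᶠ k in l, k ∈ D.farOut) {θ ξ₀ : EuclideanSpace ℝ (Fin d)} (hθ : ‖θ‖ = 1)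
    (hx : Filter.Tendsto (fun k => ((D.s k : ℝ) ^ 2)⁻¹ • D.x k) l (𝓝 θ))
    (hξ : Filter.Tendsto D.ξ l (𝓝 ξ₀)) {φ : EuclideanSpace ℝ (Fin d) → ℂ} (hφ : IsCutoff φ) :
    (θ, toBall ξ₀) ∈ globalWF φ D.distr := by
  refine Or.inr ⟨mem_sphere_zero_iff_norm.2 hθ,
    mem_closedBall_zero_iff.2 (norm_toBall_lt_one ξ₀).le, ?_⟩
  rintro ⟨ψ, hψ, hψθ, R, hR, hcs⟩
  refine hcs (Or.inl ⟨ξ₀, ?_, rfl⟩)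
  rintro ⟨U, hUo, hξU, h, -, hh⟩
  obtain ⟨χ, hχc, hχU, hχ1, -⟩ := exists_schwartz_bump (hUo.mem_nhds hξU)
  have hn := tendsto_norm_of_eventually_eq hl (hk.mono D.norm_x)
  have hm := isSymbol_asympCutoff hφ hψ hR
  set m := asympCutoff φ ψ R with hmdef
  have hmx : Filter.Tendsto (fun k => m (D.x k)) l (𝓝 (ψ θ)) := by
    refine (tendsto_asympCutoff hφ hψ hR hθ (D.tendsto_s_sq.mono_left hl) hx).congr fun k => ?_
    rw [smul_inv_smul₀ (pow_pos (D.s_pos k) 2).ne']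
  have hG := hm.tendsto_smulLeftCLM hn hmx (tendsto_const_nhds (x := fourierSchwartz d χ))
  set G : ℕ → 𝓢(EuclideanSpace ℝ (Fin d), ℂ) := fun k =>
    SchwartzMap.smulLeftCLM ℂ (fun z => m (D.x k + z)) (fourierSchwartz d χ) with hGdef
  have h1 : Filter.Tendsto (fun k => planeWave (D.ξ k) (D.x k) *
      ∫ z, D.freqPart z * planeWave (D.x k) z * fourierSchwartz d (G k) z) l (𝓝 0) := by
    have := tendsto_integral_mul_planeWave D.measurable_freqPart.aestronglyMeasurable
      D.norm_freqPart_le hn (((fourierSchwartz d).continuous.tendsto _).comp hG)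
    refine squeeze_zero_norm (fun k => ?_) (tendsto_zero_iff_norm_tendsto_zero.1 this)
    rw [norm_mul, norm_planeWave, one_mul]
    rfl
  have h2 := tendsto_integral_mul_of_tendsto_pointwise (l := l) (C := 1)
    (h := fun k z => planeWave (D.ξ k) (D.x k + z) * D.farPart (D.x k + z) *
      planeWave (-D.ξ k) z) (h₀ := planeWave (-ξ₀))
    (fun k => (((continuous_planeWave _).measurable.comp (measurable_const_add _)).mul
      (D.measurable_farPart.comp (measurable_const_add _))).mul
        (continuous_planeWave _).measurable |>.aestronglyMeasurable)
    (fun k z => by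
      rw [norm_mul, norm_mul, norm_planeWave, norm_planeWave, one_mul, mul_one]
      exact D.norm_farPart_le _)
    (fun z => by
      have := (tendsto_planeWave_mul_lacunarySum hl D.norm_x D.ξ hk z).mul
        (tendsto_planeWave hξ.neg z)
      rwa [one_mul] at this) hG
  have h3 := h2.add h1
  -- the same quantity tends to `0`, by the Riemann-Lebesgue lemma for `h * χ`
  have h4 : Filter.Tendsto (fun k => planeWave (D.ξ k) (D.x k) *
      ∫ y, planeWave (-D.x k) y * (h y * χ y)) l (𝓝 0) := by
    have := (tendsto_integral_planeWave_mul (fun y => h y * χ y)).comp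
      (tendsto_cocompact_of_norm (hn.congr fun k => (norm_neg (D.x k)).symm))
    refine squeeze_zero_norm (fun k => ?_) (tendsto_zero_iff_norm_tendsto_zero.1 this)
    rw [norm_mul, norm_planeWave, one_mul]
    rfl
  have h5 := tendsto_nhds_unique (h3.congr fun k => ?_) h4
  · rw [add_zero] at h5
    simp only [smul_apply, smul_eq_mul, mul_left_comm _ (ψ θ)] at h5
    rw [integral_const_mul, integral_planeWave_mul_fourierSchwartz, hχ1.self_of_nhds, mul_one,
      mul_eq_zero] at h5
    refine h5.elim hψθ fun h => ?_
    have : ((2 * Real.pi) ^ d : ℝ) ≠ 0 := by positivity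
    exact this (by exact_mod_cast h)
  · have hsupp : tsupport (phaseShift 0 (D.x k) χ) ⊆ tsupport χ := by
      refine closure_mono fun y hy => ?_
      rw [Function.mem_support, phaseShift_apply, sub_zero] at hy
      exact right_ne_zero_of_mul hy
    have h6 := hh (phaseShift 0 (D.x k) χ)
      (hχc.of_isClosed_subset (isClosed_tsupport _) hsupp) (hsupp.trans hχU)
    have h7 : D.distr (SchwartzMap.smulLeftCLM ℂ m
        (fourierSchwartz d (phaseShift 0 (D.x k) χ))) = D.distr (phaseShift (D.x k) 0 (G k)) := by
      rw [fourierSchwartz_phaseShift, neg_zero, planeWave_zero_left, one_smul,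
        smulLeftCLM_phaseShift hm.hasTemperateGrowth]
    have h8 : D.distr (phaseShift (D.x k) 0 (G k)) = ∫ y, planeWave (-D.x k) y * (h y * χ y) := by
      rw [← h7]
      refine Eq.trans h6 ?_
      congr 1; ext y
      rw [phaseShift_apply, sub_zero]
      ring
    rw [← h8, distr_phaseShift, mul_add, neg_zero, planeWave_zero_left, one_mul,
      ← integral_const_mul (planeWave (D.ξ k) (D.x k))
        (fun z => D.farPart (D.x k + z) * planeWave 0 z * G k z)]
    simp only [zero_add]
    congr 2; ext z
    rw [planeWave_add_right, planeWave_zero_left]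
    linear_combination planeWave (D.ξ k) (D.x k) * D.farPart (D.x k + z) *
      G k z * planeWave_mul_neg (D.ξ k) z

/-- A limit of packets of high frequency, whose positions and frequencies are both large of the same
order, lies in the wave front set. -/
theorem mem_globalWF_of_corner [l.NeBot] [l.IsCountablyGenerated] (hl : l ≤ Filter.atTop)
    (hk : ∀ᶠ k in l, k ∈ D.highFreq) (hxn : ∀ᶠ k in l, ‖D.x k‖ = (D.s k : ℝ) ^ 2)
    {θ η : EuclideanSpace ℝ (Fin d)} (hθ : ‖θ‖ = 1) (hη : ‖η‖ = 1)
    (hx : Filter.Tendsto (fun k => ((D.s k : ℝ) ^ 2)⁻¹ • D.x k) l (𝓝 θ))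
    (hξ : Filter.Tendsto (fun k => ((D.s k : ℝ) ^ 2)⁻¹ • D.ξ k) l (𝓝 η))
    {φ : EuclideanSpace ℝ (Fin d) → ℂ} (hφ : IsCutoff φ) :
    (θ, η) ∈ globalWF φ D.distr := by
  refine Or.inr ⟨mem_sphere_zero_iff_norm.2 hθ, mem_closedBall_zero_iff.2 hη.le, ?_⟩
  rintro ⟨ψ, hψ, hψθ, R, hR, hcs⟩
  refine hcs (Or.inr ⟨mem_sphere_zero_iff_norm.2 hη, ?_⟩)
  rintro ⟨R', hR', ψ', hψ', hψη, w, hw⟩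
  have hnx := tendsto_norm_of_eventually_eq hl hxn
  have hnξ := tendsto_norm_of_eventually_eq hl (hk.mono D.norm_ξ)
  have hm := isSymbol_asympCutoff hφ hψ hR
  have hκ := isSymbol_asympCutoff hφ hψ' hR'
  set m := asympCutoff φ ψ R with hmdef
  set κ := asympCutoff φ ψ' R' with hκdef
  have hmx : Filter.Tendsto (fun k => m (D.x k)) l (𝓝 (ψ θ)) := by
    refine (tendsto_asympCutoff hφ hψ hR hθ (D.tendsto_s_sq.mono_left hl) hx).congr fun k => ?_
    rw [smul_inv_smul₀ (pow_pos (D.s_pos k) 2).ne']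
  have hκξ : Filter.Tendsto (fun k => κ (D.ξ k)) l (𝓝 (ψ' η)) := by
    refine (tendsto_asympCutoff hφ hψ' hR' hη (D.tendsto_s_sq.mono_left hl) hξ).congr fun k => ?_
    rw [smul_inv_smul₀ (pow_pos (D.s_pos k) 2).ne']
  -- a test function whose Fourier transform does not vanish at the origin
  set χ := fourierSchwartz d D.ρ with hχ
  set K : ℕ → 𝓢(EuclideanSpace ℝ (Fin d), ℂ) := fun k =>
    SchwartzMap.smulLeftCLM ℂ (fun z => κ (D.ξ k + z)) χ with hKdef
  have hK : Filter.Tendsto K l (𝓝 (ψ' η • χ)) :=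
    hκ.tendsto_smulLeftCLM hnξ hκξ tendsto_const_nhds
  set G : ℕ → 𝓢(EuclideanSpace ℝ (Fin d), ℂ) := fun k =>
    SchwartzMap.smulLeftCLM ℂ (fun z => m (D.x k + z)) (fourierSchwartz d (K k)) with hGdef
  have hG : Filter.Tendsto G l (𝓝 (ψ θ • fourierSchwartz d (ψ' η • χ))) :=
    hm.tendsto_smulLeftCLM hnx hmx (((fourierSchwartz d).continuous.tendsto _).comp hK)
  have h1 := tendsto_integral_mul_of_tendsto_pointwise (l := l) (C := 1)
    (h := fun k z => D.farPart (D.x k + z) * planeWave (D.ξ k) z) (h₀ := fun _ => 0)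
    (fun k => ((D.measurable_farPart.comp (measurable_const_add _)).mul
        (continuous_planeWave _).measurable).aestronglyMeasurable)
    (fun k z => by
      rw [norm_mul, norm_planeWave, mul_one]
      exact D.norm_farPart_le _)
    (fun z => by
      have := tendsto_lacunarySum_zero hl D.norm_x D.ξ
        (hk.mono fun k hk => Set.disjoint_left.1 D.disjoint hk) hxn z
      refine squeeze_zero_norm (fun k => ?_) (tendsto_zero_iff_norm_tendsto_zero.1 this)
      rw [norm_mul, norm_planeWave, mul_one]
      rfl) hG
  have h2 := tendsto_integral_mul_of_tendsto_pointwise (l := l) (C := 1)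
    (h := fun k z => planeWave (D.x k) (-D.ξ k + z) * D.freqPart (-D.ξ k + z)) (h₀ := fun _ => 1)
    (fun k => (((continuous_planeWave _).measurable.comp (measurable_const_add _)).mul
      (D.measurable_freqPart.comp (measurable_const_add _))).aestronglyMeasurable)
    (fun k z => by
      rw [norm_mul, norm_planeWave, one_mul]
      exact D.norm_freqPart_le _)
    (fun z => tendsto_planeWave_mul_lacunarySum hl D.norm_neg_ξ D.x hk z)
    (((fourierSchwartz d).continuous.tendsto _).comp hG)
  have h3 := h1.add h2
  -- the same quantity tends to `0`, since the Schwartz function `w` vanishes at infinity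
  obtain ⟨C, -, hC⟩ := w.decay 0 0
  have h4 := tendsto_integral_mul_of_tendsto_pointwise (l := l) (C := C)
    (h := fun k z => w (D.ξ k + z) * planeWave (-D.x k) (D.ξ k + z)) (h₀ := fun _ => 0)
    (fun k => (((w.continuous.mul (continuous_planeWave _)).comp
      (continuous_const.add continuous_id)).aestronglyMeasurable))
    (fun k z => by
      rw [norm_mul, norm_planeWave, mul_one]
      simpa using hC (D.ξ k + z))
    (fun z => by
      have hz : Filter.Tendsto (fun k => D.ξ k + z) l (Filter.cocompact _) := by
        refine tendsto_cocompact_of_norm ?_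
        refine Filter.tendsto_atTop_mono (f := fun k => ‖D.ξ k‖ - ‖z‖) (fun k => ?_)
          (Filter.tendsto_atTop_add_const_right _ _ hnξ)
        have : ‖D.ξ k‖ ≤ ‖D.ξ k + z‖ + ‖z‖ := by simpa using norm_sub_le (D.ξ k + z) z
        linarith
      have := (zero_at_infty w).comp hz
      refine squeeze_zero_norm (fun k => ?_) (tendsto_zero_iff_norm_tendsto_zero.1 this)
      rw [norm_mul, norm_planeWave, mul_one]
      rfl) (tendsto_const_nhds (x := χ))
  have h5 := tendsto_nhds_unique (h3.congr fun k => ?_) h4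
  · have h6 := integral_planeWave_mul_fourierSchwartz (ψ θ • fourierSchwartz d (ψ' η • χ)) 0
    have h7 := integral_planeWave_mul_fourierSchwartz D.ρ 0
    simp only [neg_zero, planeWave_zero_left, one_mul] at h6 h7
    simp only [zero_mul, one_mul, integral_zero, zero_add, h6] at h5
    rw [map_smul, smul_apply, smul_apply, fourierSchwartz_apply] at h5
    simp only [planeWave_zero_left, one_mul, hχ, h7, D.ρ_zero, smul_eq_mul, mul_one,
      mul_eq_zero] at h5
    have : (((2 * Real.pi) ^ d : ℝ) : ℂ) ≠ 0 := by
      have : ((2 * Real.pi) ^ d : ℝ) ≠ 0 := by positivity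
      exact_mod_cast this
    tauto
  · have h6 := hw (phaseShift (D.ξ k) (D.x k) χ)
    have h7 : D.distr (SchwartzMap.smulLeftCLM ℂ m (fourierSchwartz d
        (SchwartzMap.smulLeftCLM ℂ κ (phaseShift (D.ξ k) (D.x k) χ)))) =
        planeWave (-D.ξ k) (D.x k) * D.distr (phaseShift (D.x k) (-D.ξ k) (G k)) := by
      rw [smulLeftCLM_phaseShift hκ.hasTemperateGrowth, fourierSchwartz_phaseShift, map_smul,
        smulLeftCLM_phaseShift hm.hasTemperateGrowth, map_smul, smul_eq_mul]
    have h8 : planeWave (-D.ξ k) (D.x k) * D.distr (phaseShift (D.x k) (-D.ξ k) (G k)) =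
        ∫ z, w (D.ξ k + z) * planeWave (-D.x k) (D.ξ k + z) * χ z := by
      rw [← h7]
      refine Eq.trans h6 ?_
      rw [← integral_add_left_eq_self _ (D.ξ k)]
      congr 1; ext y
      rw [phaseShift_apply, add_sub_cancel_left]
      ring
    rw [← h8, distr_phaseShift, mul_add, neg_neg, ← mul_assoc, planeWave_neg_mul, one_mul,
      ← integral_const_mul (planeWave (-D.ξ k) (D.x k))
        (fun z => D.freqPart (-D.ξ k + z) * planeWave (D.x k) z * fourierSchwartz d (G k) z)]
    congr 2; ext z
    rw [planeWave_add_right, planeWave_comm (D.x k) (-D.ξ k)]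
    simp only [Function.comp]
    ring

end PacketFamily

/-! ### The choice of the packets -/

open Classical in
/-- A point of `ℝ^d` whose image in `𝔹^d` is close to `p`: the preimage of `p` if `p` is in the
interior of the ball, and the point at distance `t` in the direction `p` otherwise. -/
noncomputable def place (t : ℝ) (p : 𝔼) : 𝔼 := if ‖p‖ < 1 then ofBall p else t • p

theorem place_of_norm_lt {p : 𝔼} (hp : ‖p‖ < 1) (t : ℝ) : place t p = ofBall p := if_pos hp

theorem place_of_norm_eq {p : 𝔼} (hp : ‖p‖ = 1) (t : ℝ) : place t p = t • p := if_neg hp.not_lt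

theorem norm_place_of_norm_eq {p : 𝔼} (hp : ‖p‖ = 1) {t : ℝ} (ht : 0 ≤ t) : ‖place t p‖ = t := by
  rw [place_of_norm_eq hp, norm_smul, hp, mul_one, Real.norm_of_nonneg ht]

theorem norm_place_le {p : 𝔼} (hp : ‖p‖ ≤ 1) {t : ℝ} (ht : ‖ofBall p‖ ≤ t) :
    ‖place t p‖ ≤ t := by
  rcases hp.lt_or_eq with hp | hp
  · rwa [place_of_norm_lt hp]
  · exact (norm_place_of_norm_eq hp ((norm_nonneg _).trans ht)).le

theorem norm_toBall_place_sub_le {p : 𝔼} (hp : ‖p‖ ≤ 1) {t : ℝ} (ht : 0 < t) :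
    ‖toBall (place t p) - p‖ ≤ t⁻¹ := by
  rcases hp.lt_or_eq with hp | hp
  · rw [place_of_norm_lt hp, toBall_ofBall hp, sub_self, norm_zero]
    positivity
  · rw [place_of_norm_eq hp]
    exact norm_toBall_smul_sub_le ht hp

theorem continuousAt_ofBall {p : 𝔼} (hp : ‖p‖ < 1) : ContinuousAt (ofBall : 𝔼 → 𝔼) p := by
  have h : √(1 - ‖p‖ ^ 2) ≠ 0 := by
    refine (Real.sqrt_pos.2 ?_).ne'
    nlinarith [norm_nonneg p]
  have h1 : ContinuousAt (fun p : 𝔼 => √(1 - ‖p‖ ^ 2)) p := by fun_prop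
  exact (h1.inv₀ h).smul continuousAt_id

theorem exists_packetFamily {q : ℕ → 𝔼 × 𝔼} (hq₁ : ∀ k, ‖(q k).1‖ ≤ 1) (hq₂ : ∀ k, ‖(q k).2‖ ≤ 1)
    {A B : Set ℕ} (hAB : Disjoint A B) (hA : ∀ k ∈ A, ‖(q k).2‖ = 1)
    (hB : ∀ k ∈ B, ‖(q k).1‖ = 1) :
    ∃ D : PacketFamily d, D.highFreq = A ∧ D.farOut = B ∧
      (∀ k, D.x k = place ((D.s k : ℝ) ^ 2) (q k).1) ∧
      ∀ k, D.ξ k = place ((D.s k : ℝ) ^ 2) (q k).2 := by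
  obtain ⟨ρ, hρc, hρs, hρ1, hρn⟩ := exists_schwartz_bump (x₀ := (0 : 𝔼))
    (closedBall_mem_nhds 0 one_pos)
  set a : ℕ → ℝ := fun k => ‖ofBall (q k).1‖ + ‖ofBall (q k).2‖ with ha
  have ha0 : ∀ k, 0 ≤ a k := fun k => by positivity
  set b : ℕ → ℝ := fun k => 1 + ∑ i ∈ Finset.range (k + 1), a i with hb
  have hb1 : ∀ k, 1 ≤ b k := fun k =>
    le_add_of_nonneg_right (Finset.sum_nonneg fun i _ => ha0 i)
  have hab : ∀ k, a k ≤ b k := fun k => by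
    have := Finset.single_le_sum (f := a) (fun i _ => ha0 i)
      (Finset.mem_range.2 (Nat.lt_succ_self k))
    simp only [hb]
    linarith
  have hbm : ∀ k, b k ≤ b (k + 1) := fun k => by
    simp only [hb, Finset.sum_range_succ _ (k + 1)]
    linarith [ha0 (k + 1)]
  have hs0 : ∀ k, 0 < (2 : ℝ) ^ (k + 2) * b k := fun k =>
    mul_pos (by positivity) (zero_lt_one.trans_le (hb1 k))
  have h2 : ∀ k, (1 : ℝ) ≤ 2 ^ (k + 2) := fun k => one_le_pow₀ one_le_two
  have has : ∀ k, a k ≤ ((2 : ℝ) ^ (k + 2) * b k) ^ 2 := fun k => by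
    have h3 : b k ≤ 2 ^ (k + 2) * b k :=
      le_mul_of_one_le_left (zero_le_one.trans (hb1 k)) (h2 k)
    have h4 := hb1 k
    have h5 := hab k
    nlinarith
  refine ⟨{
    s := fun k => Units.mk0 (2 ^ (k + 2) * b k) (hs0 k).ne'
    x := fun k => place ((2 ^ (k + 2) * b k) ^ 2) (q k).1
    ξ := fun k => place ((2 ^ (k + 2) * b k) ^ 2) (q k).2
    highFreq := A
    farOut := B
    ρ := ρ
    disjoint := hAB
    le_s := fun k => le_mul_of_one_le_right (by positivity) (hb1 k)
    s_succ := fun k => ?_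
    norm_x_le := fun k => norm_place_le (hq₁ k)
      ((le_add_of_nonneg_right (norm_nonneg _)).trans (has k))
    norm_ξ_le := fun k => norm_place_le (hq₂ k)
      ((le_add_of_nonneg_left (norm_nonneg _)).trans (has k))
    norm_ξ := fun k hk => norm_place_of_norm_eq (hA k hk) (sq_nonneg _)
    norm_x := fun k hk => norm_place_of_norm_eq (hB k hk) (sq_nonneg _)
    ρ_zero := hρ1.self_of_nhds
    norm_ρ_le := hρn
    ρ_eq_zero := fun z hz => ?_ }, rfl, rfl, fun _ => rfl, fun _ => rfl⟩
  · simp only [Units.val_mk0]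
    calc 2 * ((2 : ℝ) ^ (k + 2) * b k) = 2 ^ (k + 1 + 2) * b k := by ring
      _ ≤ _ := mul_le_mul_of_nonneg_left (hbm k) (by positivity)
  · by_contra hne
    have := hρs (subset_tsupport _ (Function.mem_support.2 hne))
    rw [mem_closedBall_zero_iff] at this
    linarith

/-- A sequence which visits each point of a dense subset of each of the sets `P i` infinitely
often. -/
theorem exists_seq_dense {α ι : Type*} [TopologicalSpace α] [SecondCountableTopology α]
    [Countable ι] (P : ι → Set α) (a : α) : ∃ q : ℕ → α, (∀ k, q k = a ∨ ∃ i, q k ∈ P i) ∧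
      ∀ i, ∀ p ∈ P i, (Filter.atTop ⊓ Filter.comap q (𝓝[P i] p)).NeBot := by
  have h : ∀ i, ∃ t ⊆ P i, t.Countable ∧ P i ⊆ closure t := fun i => by
    obtain ⟨t, htc, htd⟩ := TopologicalSpace.exists_countable_dense (P i)
    exact ⟨(↑) '' t, by simp, htc.image _, fun p hp => by
      have := image_closure_subset_closure_image (continuous_subtype_val (p := (· ∈ P i)))
        (mem_image_of_mem _ (htd ⟨p, hp⟩))
      exact this⟩
  choose t ht htc htd using h
  obtain ⟨f, hf⟩ := ((countable_iUnion htc).insert a).exists_eq_range (insert_nonempty _ _)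
  refine ⟨fun k => f k.unpair.1, fun k => ?_, fun i p hp => ?_⟩
  · have : f k.unpair.1 ∈ insert a (⋃ i, t i) := hf ▸ mem_range_self _
    refine this.imp id fun h => ?_
    obtain ⟨i, hi⟩ := mem_iUnion.1 h
    exact ⟨i, ht i hi⟩
  · rw [Filter.inf_neBot_iff]
    rintro s hs s' ⟨u, hu, hus⟩
    obtain ⟨N, hN⟩ := Filter.mem_atTop_sets.1 hs
    have := mem_closure_iff_nhdsWithin_neBot.1 (htd i hp)
    obtain ⟨b, hbu, hbt⟩ := this.nonempty_of_mem
      (Filter.inter_mem (nhdsWithin_mono p (ht i) hu) self_mem_nhdsWithin)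
    have hbf : b ∈ range f := hf ▸ mem_insert_of_mem _ (mem_iUnion.2 ⟨i, hbt⟩)
    obtain ⟨n, rfl⟩ := hbf
    refine ⟨Nat.pair n N, hN _ (Nat.right_le_pair n N), hus ?_⟩
    simpa using hbu

theorem norm_of_mem_frontier {p : 𝔼 × 𝔼}
    (hp : p ∈ frontier (closedBall (0 : 𝔼) 1 ×ˢ closedBall (0 : 𝔼) 1)) :
    ‖p.1‖ ≤ 1 ∧ ‖p.2‖ ≤ 1 ∧ (‖p.1‖ = 1 ∨ ‖p.2‖ = 1) := by
  rw [frontier_prod_eq, frontier_closedBall _ one_ne_zero, closure_closedBall] at hp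
  rcases hp with ⟨h1, h2⟩ | ⟨h1, h2⟩ <;>
    simp only [mem_closedBall_zero_iff, mem_sphere_zero_iff_norm] at h1 h2
  · exact ⟨h1, h2.le, Or.inr h2⟩
  · exact ⟨h1.le, h2, Or.inl h1⟩

end GlobalWF

theorem theorem1p8 (d : ℕ) (Γ : Set (EuclideanSpace ℝ (Fin d) × EuclideanSpace ℝ (Fin d)))
    (hΓ : Γ ⊆ frontier (closedBall (0 : EuclideanSpace ℝ (Fin d)) 1 ×ˢ
      closedBall (0 : EuclideanSpace ℝ (Fin d)) 1))
    (hclosed : IsClosed Γ) :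
    ∃ T : 𝓢'(EuclideanSpace ℝ (Fin d), ℂ),
      ∀ φ : EuclideanSpace ℝ (Fin d) → ℂ, GlobalWF.IsCutoff φ → GlobalWF.globalWF φ T = Γ := by
  open GlobalWF GlobalWF.PacketFamily in
  -- the three strata of the boundary: finite position, finite frequency, and the corner
  set P : Fin 3 → Set (EuclideanSpace ℝ (Fin d) × EuclideanSpace ℝ (Fin d)) :=
    ![{p ∈ Γ | ‖p.1‖ < 1}, {p ∈ Γ | ‖p.2‖ < 1}, {p ∈ Γ | ‖p.1‖ = 1 ∧ ‖p.2‖ = 1}] with hP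
  obtain ⟨q, hq, hqP⟩ := exists_seq_dense P 0
  have hPΓ : ∀ i, P i ⊆ Γ := fun i p hp => by fin_cases i <;> exact hp.1
  have hqn : ∀ k, ‖(q k).1‖ ≤ 1 ∧ ‖(q k).2‖ ≤ 1 := fun k => by
    rcases hq k with h | ⟨i, hi⟩
    · simp [h]
    · obtain ⟨h1, h2, -⟩ := norm_of_mem_frontier (hΓ (hPΓ i hi))
      exact ⟨h1, h2⟩
  obtain ⟨D, hDA, hDB, hDx, hDξ⟩ := exists_packetFamily (fun k => (hqn k).1) (fun k => (hqn k).2)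
    (A := {k | q k ∈ Γ ∧ ‖(q k).2‖ = 1}) (B := {k | q k ∈ Γ ∧ ‖(q k).2‖ < 1})
    (Set.disjoint_left.2 fun k hA hB => hB.2.ne hA.2) (fun k hk => hk.2)
    (fun k hk => (norm_of_mem_frontier (hΓ hk.1)).2.2.resolve_right hk.2.ne)
  have hmemA : ∀ k, q k ∈ Γ → ‖(q k).2‖ = 1 → k ∈ D.highFreq := fun k h1 h2 => hDA ▸ ⟨h1, h2⟩
  have hmemB : ∀ k, q k ∈ Γ → ‖(q k).2‖ < 1 → k ∈ D.farOut := fun k h1 h2 => hDB ▸ ⟨h1, h2⟩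
  have hs : ∀ k, (0 : ℝ) < (D.s k : ℝ) ^ 2 := fun k => pow_pos (D.s_pos k) 2
  refine ⟨D.distr, fun φ hφ => Subset.antisymm (fun p hp => ?_) (fun p hp => ?_)⟩
  · by_contra hpΓ
    obtain ⟨ε, hε, hball⟩ := Metric.isOpen_iff.1 hclosed.isOpen_compl p hpΓ
    refine D.notMem_globalWF_distr hφ (half_pos hε) ?_ hp
    filter_upwards [D.tendsto_s_sq.eventually_ge_atTop (ε / 2)⁻¹] with k hk hkS
    have hqΓ : q k ∈ Γ := by
      rw [hDA, hDB] at hkS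
      exact hkS.elim (fun h => h.1) (fun h => h.1)
    have hinv : ((D.s k : ℝ) ^ 2)⁻¹ ≤ ε / 2 := inv_le_of_inv_le₀ (half_pos hε) hk
    have h1 := (norm_toBall_place_sub_le (hqn k).1 (hs k)).trans hinv
    have h2 := (norm_toBall_place_sub_le (hqn k).2 (hs k)).trans hinv
    rw [← hDx] at h1
    rw [← hDξ] at h2
    by_contra! hlt
    refine hball (?_ : q k ∈ ball p ε) hqΓ
    have h3 := norm_sub_le_norm_sub_add_norm_sub (q k).1 (toBall (D.x k)) p.1
    have h4 := norm_sub_le_norm_sub_add_norm_sub (q k).2 (toBall (D.ξ k)) p.2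
    rw [norm_sub_rev (q k).1 (toBall (D.x k))] at h3
    rw [norm_sub_rev (q k).2 (toBall (D.ξ k))] at h4
    rw [mem_ball, Prod.dist_eq, dist_eq_norm, dist_eq_norm]
    exact max_lt (by linarith [hlt.1]) (by linarith [hlt.2])
  · -- a filter along which the centers of the packets approach `p` within its stratum
    have key : ∀ i, p ∈ P i → ∃ l : Filter ℕ, l.NeBot ∧ l.IsCountablyGenerated ∧
        l ≤ Filter.atTop ∧ Filter.Tendsto q l (𝓝 p) ∧ ∀ᶠ k in l, q k ∈ P i := fun i hi =>
      ⟨_, hqP i p hi, inferInstance, inf_le_left,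
        (Filter.tendsto_comap.mono_left inf_le_right).mono_right nhdsWithin_le_nhds,
        (Filter.tendsto_comap.mono_left inf_le_right).eventually self_mem_nhdsWithin⟩
    have hxs : ∀ {l : Filter ℕ}, Filter.Tendsto q l (𝓝 p) → (∀ᶠ k in l, ‖(q k).1‖ = 1) →
        Filter.Tendsto (fun k => ((D.s k : ℝ) ^ 2)⁻¹ • D.x k) l (𝓝 p.1) := fun hlq hl =>
      ((continuous_fst.tendsto p).comp hlq).congr' (by
        filter_upwards [hl] with k hk
        rw [hDx, place_of_norm_eq hk, inv_smul_smul₀ (hs k).ne']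
        rfl)
    have hξs : ∀ {l : Filter ℕ}, Filter.Tendsto q l (𝓝 p) → (∀ᶠ k in l, ‖(q k).2‖ = 1) →
        Filter.Tendsto (fun k => ((D.s k : ℝ) ^ 2)⁻¹ • D.ξ k) l (𝓝 p.2) := fun hlq hl =>
      ((continuous_snd.tendsto p).comp hlq).congr' (by
        filter_upwards [hl] with k hk
        rw [hDξ, place_of_norm_eq hk, inv_smul_smul₀ (hs k).ne']
        rfl)
    obtain ⟨hp1, hp2, hp12⟩ := norm_of_mem_frontier (hΓ hp)
    rcases hp1.lt_or_eq with hp1 | hp1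
    · obtain ⟨l, _, _, hl, hlq, hlP⟩ := key 0 ⟨hp, hp1⟩
      have hq2 : ∀ᶠ k in l, ‖(q k).2‖ = 1 := hlP.mono fun k hk =>
        (norm_of_mem_frontier (hΓ hk.1)).2.2.resolve_left hk.2.ne
      have := mem_globalWF_of_highFreq hl
        ((hlP.and hq2).mono fun k hk => hmemA k hk.1.1 hk.2) (hp12.resolve_left hp1.ne)
        (((continuousAt_ofBall hp1).tendsto.comp ((continuous_fst.tendsto p).comp hlq)).congr' (by
          filter_upwards [hlP] with k hk
          rw [hDx, place_of_norm_lt hk.2]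
          rfl)) (hξs hlq hq2) φ
      rwa [toBall_ofBall hp1] at this
    rcases hp2.lt_or_eq with hp2 | hp2
    · obtain ⟨l, _, _, hl, hlq, hlP⟩ := key 1 ⟨hp, hp2⟩
      have hq1 : ∀ᶠ k in l, ‖(q k).1‖ = 1 := hlP.mono fun k hk =>
        (norm_of_mem_frontier (hΓ hk.1)).2.2.resolve_right hk.2.ne
      have := mem_globalWF_of_farOut hl (hlP.mono fun k hk => hmemB k hk.1 hk.2) hp1
        (hxs hlq hq1)
        (((continuousAt_ofBall hp2).tendsto.comp ((continuous_snd.tendsto p).comp hlq)).congr' (by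
          filter_upwards [hlP] with k hk
          rw [hDξ, place_of_norm_lt hk.2]
          rfl)) hφ
      rwa [toBall_ofBall hp2] at this
    · obtain ⟨l, _, _, hl, hlq, hlP⟩ := key 2 ⟨hp, hp1, hp2⟩
      exact mem_globalWF_of_corner hl (hlP.mono fun k hk => hmemA k hk.1 hk.2.2)
        (hlP.mono fun k hk => by rw [hDx, norm_place_of_norm_eq hk.2.1 (hs k).le]) hp1 hp2
        (hxs hlq (hlP.mono fun k hk => hk.2.1)) (hξs hlq (hlP.mono fun k hk => hk.2.2)) hφ
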